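/- Let $-\infty<a<b<\infty$, $d\in\mathbb N$, $K,L\in(0,\infty)$, $\varrho\in(0,1]$ and $p\in[2,\infty)$. Equip $\mathbb R^d$ with $\|x\|=\sum_{k=1}^d|x_k|$, write $B(x,r)$ for the closed ball of radius $r$ about $x$, and put $$\bar R=\max\Bigl\{K(1+b-a)\bigl(1+e^{K(b-a)}(1+K(b-a))\bigr),\ K+(b-a)(1+K)+\bigl(\tfrac1K+1\bigr)(1+K(b-a))\bigl(e^{K(b-a)(1+K(b-a))}(1+K)-1\bigr)\Bigr\}.$$ Let $F^{\varrho}=F^{\varrho}(K,L)$ be the class of pairs $(\eta,f)$ with $\eta\in\mathbb R^d$, $\|\eta\|\le K$, and $f:[a,b]\times\mathbb R^d\to\mathbb R^d$ continuous such that $\|f(t,x)\|\le K(1+\|x\|)$ for all $t\in[a,b]$, $x\in\mathbb R^d$; $\|f(t,x)-f(s,x)\|\le L|t-s|^{\varrho}$ for all $t,s\in[a,b]$, $x\in B(\eta,\bar R)$; and $\|f(t,x)-f(t,y)\|\le L\|x-y\|$ for all $t\in[a,b]$, $x,y\in B(\eta,\bar R)$. For $\delta\in[0,1]$ let $V_{(\eta,f)}(\delta)$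 be the set of pairs $(\tilde\eta,\tilde f)$ with $\tilde\eta\in B(\eta,\delta)$ and $\tilde f=f+\tilde\delta_f$, where $\tilde\delta_f:[a,b]\times\mathbb R^d\to\mathbb R^d$ is Borel measurable and $\|\tilde\delta_f(t,y)\|\le\delta$ for all $(t,y)\in[a,b]\times\mathbb R^d$. Let $\tau_1,\tau_2,\dots$ be independent random variables, uniformly distributed on $[0,1]$, on a probability space $(\Omega,\Sigma,\mathbb P)$. For $n\ge 1$ let $h=(b-a)/n$, $t_j=a+jh$, $\bar V^0=\tilde\eta$ and, for $j=1,\dots,n$, $$\bar V^j_\tau=\bar V^{j-1}+h\tau_j\tilde f(t_{j-1},\bar V^{j-1}),\qquad \bar V^j=\bar V^{j-1}+h\tilde f(t_{j-1}+\tau_jh,\bar V^j_\tau),$$ and let $\bar l=\bar l(\tilde\eta,\tilde f,\delta):[a,b]\to\mathbb R^d$ be the function with $\bar l(t)=\frac{\bar V^{j+1}-\bar V^{j}}{t_{j+1}-t_j}(t-t_j)+\bar V^j$ for $t\in[t_j,t_{j+1}]$, $j=0,\dots,n-1$. Theorem. For every $(\eta,f)\in F^{\varrho}$ the problem $z'(t)=f(t,z(t))$,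 $t\in[a,b]$, $z(a)=\eta$ has a unique solution $z=z(\eta,f)$ on $[a,b]$. There exists a constant $C>0$, depending only on $a,b,d,\varrho,K,L$ and $p$, such that for all $n\ge\lfloor b-a\rfloor+1$, $\delta\in[0,1]$, $(\eta,f)\in F^{\varrho}$ and $(\tilde\eta,\tilde f)\in V_{(\eta,f)}(\delta)$ the function $\omega\mapsto\sup_{a\le t\le b}\|z(\eta,f)(t)-\bar l(\tilde\eta,\tilde f,\delta)(\omega)(t)\|$ is measurable with respect to the completion of $\mathbb P$, and $$\Bigl(\mathbb E\Bigl[\sup_{a\le t\le b}\|z(\eta,f)(t)-\bar l(\tilde\eta,\tilde f,\delta)(t)\|^p\Bigr]\Bigr)^{1/p}\le C\bigl(h^{\varrho+1/2}+\delta\bigr).$$ -/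

import Mathlib

open MeasureTheory ProbabilityTheory Set

noncomputable section

namespace RandomizedRK

/-- The space `ℝ^d` with the norm `‖x‖ = ∑ k, |x k|`. -/
abbrev Vec (d : ℕ) : Type := PiLp 1 (fun _ : Fin d => ℝ)

/-- The radius of the ball around the initial value on which the right-hand side is assumed to be
Hölder continuous in time and Lipschitz continuous in space. -/
def radius (a b K : ℝ) : ℝ :=
  max (K * (1 + b - a) * (1 + Real.exp (K * (b - a)) * (1 + K * (b - a))))
    (K + (b - a) * (1 + K)
      + (1 / K + 1) * (1 + K * (b - a))
        * (Real.exp (K * (b - a) * (1 + K * (b - a))) * (1 + K) - 1))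

/-- `(η, f)` belongs to the class `F^ϱ(K, L)`. A right-hand side `f : [a,b] × ℝ^d → ℝ^d` is
represented by a function on `ℝ × ℝ^d` of which only the values on `[a,b] × ℝ^d` matter. -/
structure InClass (a b : ℝ) (d : ℕ) (ϱ K L : ℝ) (η : Vec d) (f : ℝ → Vec d → Vec d) : Prop where
  norm_init_le : ‖η‖ ≤ K
  continuousOn : ContinuousOn (fun q : ℝ × Vec d => f q.1 q.2) (Icc a b ×ˢ univ)
  linear_growth : ∀ t ∈ Icc a b, ∀ x, ‖f t x‖ ≤ K * (1 + ‖x‖)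
  holder_time : ∀ t ∈ Icc a b, ∀ s ∈ Icc a b, ∀ x ∈ Metric.closedBall η (radius a b K),
    ‖f t x - f s x‖ ≤ L * |t - s| ^ ϱ
  lipschitz_space : ∀ t ∈ Icc a b, ∀ x ∈ Metric.closedBall η (radius a b K),
    ∀ y ∈ Metric.closedBall η (radius a b K), ‖f t x - f t y‖ ≤ L * ‖x - y‖

/-- `z` solves `z'(t) = f(t, z(t))` on `[a,b]`, `z(a) = η` (one-sided derivatives at the end
points). If `f` is continuous on `[a,b] × ℝ^d`, then `z` is automatically `C^1` on `[a,b]`. -/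
def IsSolution (a b : ℝ) {d : ℕ} (η : Vec d) (f : ℝ → Vec d → Vec d) (z : ℝ → Vec d) : Prop :=
  z a = η ∧ ∀ t ∈ Icc a b, HasDerivWithinAt z (f t (z t)) (Icc a b) t

/-- Corrupting functions at precision level `δ`: Borel measurable on `[a,b] × ℝ^d` and bounded in
norm by `δ` there. -/
structure IsNoise (a b : ℝ) {d : ℕ} (δ : ℝ) (e : ℝ → Vec d → Vec d) : Prop where
  measurable : Measurable (fun q : Icc a b × Vec d => e (q.1 : ℝ) q.2)
  norm_le : ∀ t ∈ Icc a b, ∀ y, ‖e t y‖ ≤ δ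

/-- `(η', f')` is noisy data for `(η, f)` at precision level `δ`. -/
def IsNoisyData (a b : ℝ) {d : ℕ} (δ : ℝ) (η : Vec d) (f : ℝ → Vec d → Vec d)
    (η' : Vec d) (f' : ℝ → Vec d → Vec d) : Prop :=
  η' ∈ Metric.closedBall η δ ∧
    ∃ e : ℝ → Vec d → Vec d, IsNoise a b δ e ∧ ∀ t ∈ Icc a b, ∀ y, f' t y = f t y + e t y

/-- The step size `h = (b - a) / n`. -/
def step (a b : ℝ) (n : ℕ) : ℝ := (b - a) / n

/-- The grid points `t_j = a + j h`. -/
def grid (a b : ℝ) (n j : ℕ) : ℝ := a + j * step a b n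

/-- The values `V^0, V^1, …` of the randomized two-stage Runge–Kutta scheme for the data `(η, f)`
and a realization `τ 1, τ 2, …` of the random variables:
`V^{j+1} = V^j + h f(t_j + τ_{j+1} h, V^j + h τ_{j+1} f(t_j, V^j))`. -/
def rkValue (a b : ℝ) {d : ℕ} (n : ℕ) (η : Vec d) (f : ℝ → Vec d → Vec d) (τ : ℕ → ℝ) :
    ℕ → Vec d
  | 0 => η
  | j + 1 =>
    let V : Vec d := rkValue a b n η f τ j
    let Vτ : Vec d := V + (step a b n * τ (j + 1)) • f (grid a b n j) V
    V + step a b n • f (grid a b n j + τ (j + 1) * step a b n) Vτ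

/-- The linear function through `(t_j, V^j)` and `(t_{j+1}, V^{j+1})`. -/
def rkSegment (a b : ℝ) {d : ℕ} (n : ℕ) (η : Vec d) (f : ℝ → Vec d → Vec d) (τ : ℕ → ℝ)
    (j : ℕ) (t : ℝ) : Vec d :=
  ((t - grid a b n j) / (grid a b n (j + 1) - grid a b n j)) •
      (rkValue a b n η f τ (j + 1) - rkValue a b n η f τ j)
    + rkValue a b n η f τ j

/-- The output of the algorithm on `[a,b]`: the piecewise linear interpolation of the values `V^j`
at the grid points. See `rkApprox_eq_rkSegment`. -/
def rkApprox (a b : ℝ) {d : ℕ} (n : ℕ) (η : Vec d) (f : ℝ → Vec d → Vec d) (τ : ℕ → ℝ)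
    (t : ℝ) : Vec d :=
  rkSegment a b n η f τ (min ⌊(t - a) / step a b n⌋₊ (n - 1)) t

theorem rkApprox_eq_rkSegment {a b : ℝ} (hab : a < b) {d n : ℕ} (η : Vec d)
    (f : ℝ → Vec d → Vec d) (τ : ℕ → ℝ) {j : ℕ} (hj : j < n) {t : ℝ}
    (ht : t ∈ Icc (grid a b n j) (grid a b n (j + 1))) :
    rkApprox a b n η f τ t = rkSegment a b n η f τ j t := by
  have hn : (0 : ℝ) < n := by exact_mod_cast (Nat.zero_le j).trans_lt hj
  have hh : 0 < step a b n := div_pos (sub_pos.2 hab) hn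
  have hd : ∀ i, grid a b n (i + 1) - grid a b n i = step a b n := by
    intro i; simp only [grid]; push_cast; ring
  obtain ⟨h1, h2⟩ := ht
  have hlow : (j : ℝ) ≤ (t - a) / step a b n := by
    rw [le_div_iff₀ hh]; simp only [grid] at h1; linarith
  have hup : (t - a) / step a b n ≤ (j + 1 : ℕ) := by
    rw [div_le_iff₀ hh]; simp only [grid] at h2; linarith
  rcases hup.lt_or_eq with hlt | heq
  · have hfl : ⌊(t - a) / step a b n⌋₊ = j := by
      rw [Nat.floor_eq_iff (le_trans (Nat.cast_nonneg j) hlow)]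
      exact ⟨hlow, by simpa using hlt⟩
    have hmin : min j (n - 1) = j := by omega
    simp only [rkApprox, hfl, hmin]
  · have hteq : t = grid a b n (j + 1) := by
      rw [div_eq_iff hh.ne'] at heq; simp only [grid]; linarith
    simp only [rkApprox, heq, Nat.floor_natCast]
    rcases Nat.lt_or_ge (j + 1) n with hlt | hge
    · have hmin : min (j + 1) (n - 1) = j + 1 := by omega
      rw [hmin, hteq]
      simp only [rkSegment, hd, sub_self, zero_div, zero_smul, zero_add, div_self hh.ne', one_smul,
        sub_add_cancel]
    · have hmin : min (j + 1) (n - 1) = j := by omega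
      rw [hmin]

/-- The sup-norm distance on `[a,b]` of two `ℝ^d`-valued functions, as an extended real. -/
def supDist (a b : ℝ) {d : ℕ} (z l : ℝ → Vec d) : ENNReal :=
  ⨆ t ∈ Icc a b, ‖z t - l t‖ₑ

end RandomizedRK

end

/-! The proof separates a pathwise stability estimate from a single probabilistic bound. Inserting
the exact solution into the second stage produces on each grid interval the error `quadError`:
h·f(t_j+τh, z(t_j+τh)) minus the integral of f(s, z(s)), which equals z(t_{j+1}) − z(t_j). Its mean
is zero because τ is uniform (`integral_quadError_eq_zero`), and its size is O(h^{ϱ+1}) because s ↦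
f(s, z(s)) is ϱ-Hölder (`norm_quadError_le`).

For a fixed realization, let S_k be the sum of the first k quadrature errors. The difference V^k −
z(t_k) − S_k satisfies a linear recursion to which discrete Gronwall applies, so the error is at
most a constant times δ + h^{ϱ+1} + max_k ‖S_k‖ (`norm_rkValue_sub_le`, `norm_sub_rkApprox_le`).
Local Lipschitz continuity suffices, since the solution and both stages stay in the ball
(`InClass.mem_closedBall`, `rk_mem_closedBall`); each of the two entries of `radius` serves one of
these.

It remains to bound max_k ‖S_k‖ in L^p, coordinate by coordinate. A walk with n independent centred
steps bounded by c has a maximum of order c√n in L^p (`eLpNorm_partialSups_abs_sum_le`): after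
division by c√n its exponential is a submartingale, Doob's L² inequality handles the maximum,
Hoeffding's lemma bounds the second moment, and x^p ≤ p^p e^x returns to p-th moments. With c of
order h^{ϱ+1} and n = (b−a)/h this is the rate h^{ϱ+1/2}. -/

namespace RandomizedRK

/-! ### Truncation of the right-hand side to a ball -/

section BallRetraction

variable {E : Type*} [NormedAddCommGroup E] [NormedSpace ℝ E]

/-- The radial retraction onto the closed ball of radius `R` about `c`. -/
noncomputable def ballRetraction (c : E) (R : ℝ) (x : E) : E :=
  c + (R / max R ‖x - c‖) • (x - c)

theorem ballRetraction_mem {c : E} {R : ℝ} (hR : 0 < R) (x : E) :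
    ballRetraction c R x ∈ Metric.closedBall c R := by
  have hm : 0 < max R ‖x - c‖ := lt_max_of_lt_left hR
  rw [mem_closedBall_iff_norm, ballRetraction, add_sub_cancel_left, norm_smul, Real.norm_eq_abs,
    abs_of_nonneg (by positivity), div_mul_eq_mul_div, div_le_iff₀ hm]
  gcongr
  exact le_max_right _ _

theorem norm_ballRetraction_sub_le {c : E} {R : ℝ} (hR : 0 < R) (x : E) :
    ‖ballRetraction c R x - c‖ ≤ ‖x - c‖ := by
  have hm : 0 < max R ‖x - c‖ := lt_max_of_lt_left hR
  rw [ballRetraction, add_sub_cancel_left, norm_smul, Real.norm_eq_abs,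
    abs_of_nonneg (by positivity)]
  exact mul_le_of_le_one_left (norm_nonneg _) ((div_le_one hm).2 (le_max_left _ _))

theorem ballRetraction_of_mem {c : E} {R : ℝ} (hR : 0 < R) {x : E}
    (hx : x ∈ Metric.closedBall c R) : ballRetraction c R x = x := by
  rw [mem_closedBall_iff_norm] at hx
  rw [ballRetraction, max_eq_left hx, div_self hR.ne', one_smul, add_sub_cancel]

/-- The radial retraction need not be nonexpansive in a general norm, and the norm used later is ℓ¹.
The factor 2 comes from splitting into a common scaling of x − y and a change of scaling of y − c,
each contributing at most ‖x − y‖. -/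
theorem norm_ballRetraction_sub_ballRetraction_le {c : E} {R : ℝ} (hR : 0 < R) (x y : E) :
    ‖ballRetraction c R x - ballRetraction c R y‖ ≤ 2 * ‖x - y‖ := by
  set mx := max R ‖x - c‖ with hmx
  set my := max R ‖y - c‖ with hmy
  have hx : 0 < mx := lt_max_of_lt_left hR
  have hy : 0 < my := lt_max_of_lt_left hR
  have hRx : R / mx ≤ 1 := (div_le_one hx).2 (le_max_left _ _)
  have hm : |my - mx| ≤ ‖x - y‖ := by
    have h1 : |max (‖y - c‖) R - max (‖x - c‖) R| ≤ |‖y - c‖ - ‖x - c‖| :=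
      abs_max_sub_max_le_abs _ _ _
    have h2 := abs_norm_sub_norm_le (y - c) (x - c)
    rw [sub_sub_sub_cancel_right, norm_sub_rev y x] at h2
    rw [hmx, hmy, max_comm R, max_comm R]
    exact h1.trans h2
  have key : ballRetraction c R x - ballRetraction c R y
      = (R / mx) • (x - y) + (R / mx * ((my - mx) / my)) • (y - c) := by
    have : R / mx * ((my - mx) / my) = R / mx - R / my := by field_simp
    rw [this, ballRetraction, ballRetraction, ← hmx, ← hmy]
    module
  have h1 : ‖(R / mx) • (x - y)‖ ≤ ‖x - y‖ := by
    rw [norm_smul, Real.norm_eq_abs, abs_of_nonneg (by positivity)]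
    exact mul_le_of_le_one_left (norm_nonneg _) hRx
  have h2 : ‖(R / mx * ((my - mx) / my)) • (y - c)‖ ≤ ‖x - y‖ := by
    rw [norm_smul, Real.norm_eq_abs, abs_mul, abs_div (my - mx), abs_of_pos hy,
      abs_of_nonneg (show 0 ≤ R / mx by positivity)]
    calc R / mx * (|my - mx| / my) * ‖y - c‖ ≤ 1 * (‖x - y‖ / my) * my := by
          gcongr
          exact le_max_right _ _
      _ = ‖x - y‖ := by field_simp
  rw [key, two_mul]
  exact (norm_add_le _ _).trans (add_le_add h1 h2)

/-- A bounded, globally Lipschitz right-hand side has a solution on all of `[a,b]`. -/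
theorem exists_solution_of_bounded_lipschitz [CompleteSpace E] {a b : ℝ} (hab : a ≤ b)
    {g : ℝ → E → E} {M Λ : ℝ} (hM : 0 ≤ M) (hΛ : 0 ≤ Λ) (η : E)
    (hcont : ∀ x, ContinuousOn (fun t => g t x) (Icc a b))
    (hbdd : ∀ t ∈ Icc a b, ∀ x, ‖g t x‖ ≤ M)
    (hlip : ∀ t ∈ Icc a b, ∀ x y, ‖g t x - g t y‖ ≤ Λ * ‖x - y‖) :
    ∃ z : ℝ → E, z a = η ∧ ∀ t ∈ Icc a b, HasDerivWithinAt z (g t (z t)) (Icc a b) t := by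
  have hT : 0 ≤ M * (b - a) := mul_nonneg hM (sub_nonneg.2 hab)
  have hpl : IsPicardLindelof g (⟨a, left_mem_Icc.2 hab⟩ : Icc a b) η ⟨M * (b - a), hT⟩ 0 ⟨M, hM⟩
      ⟨Λ, hΛ⟩ :=
    { lipschitzOnWith := fun t ht => LipschitzOnWith.of_dist_le_mul fun x _ y _ => by
        simpa only [dist_eq_norm, NNReal.coe_mk] using! hlip t ht x y
      continuousOn := fun x _ => hcont x
      norm_le := fun t ht x _ => hbdd t ht x
      mul_max_le := by
        simp only [sub_self, max_eq_left (sub_nonneg.2 hab), NNReal.coe_zero, sub_zero]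
        exact le_rfl }
  exact hpl.exists_eq_forall_mem_Icc_hasDerivWithinAt₀

end BallRetraction

/-! ### A priori bound, existence and uniqueness for the differential equation -/

theorem radius_pos {a b K : ℝ} (hab : a ≤ b) (hK : 0 < K) : 0 < radius a b K := by
  have hT : 0 ≤ b - a := sub_nonneg.2 hab
  refine lt_max_of_lt_left ?_
  have : 0 < 1 + b - a := by linarith
  positivity

/-- The first entry of the maximum in `radius` dominates what Gronwall gives for ‖z(t) − η‖. -/
theorem gronwallBound_le_radius {a b K : ℝ} (hab : a ≤ b) (hK : 0 < K) {t : ℝ}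
    (ht : t ≤ b) : gronwallBound 0 K (K * (1 + K)) (t - a) ≤ radius a b K := by
  have hT : 0 ≤ b - a := sub_nonneg.2 hab
  refine le_trans ?_ (le_max_left _ _)
  rw [gronwallBound_of_K_ne_0 hK.ne']
  have h1 : K * (1 + K) / K = 1 + K := by field_simp
  have hmono : Real.exp (K * (t - a)) ≤ Real.exp (K * (b - a)) := by gcongr
  simp only [zero_mul, zero_add, h1]
  set x := K * (b - a) with hx
  have hx0 : 0 ≤ x := by positivity
  -- This is 1 − x ≤ e^{−x} multiplied by e^x.
  have hexp : Real.exp x - 1 ≤ x * Real.exp x := by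
    have h := Real.add_one_le_exp (-x)
    have h2 : Real.exp (-x) * Real.exp x = 1 := by rw [← Real.exp_add]; simp
    nlinarith [Real.exp_pos x]
  have hE := Real.exp_pos x
  calc (1 + K) * (Real.exp (K * (t - a)) - 1) ≤ (1 + K) * (x * Real.exp x) := by
        gcongr; linarith
    _ = (x + K * x) * Real.exp x := by ring
    _ ≤ (K + x) * (1 + Real.exp x * (1 + x)) := by
        nlinarith [mul_nonneg hK.le hE.le, mul_nonneg hx0 hE.le,
          mul_nonneg (mul_nonneg hx0 hx0) hE.le]
    _ = K * (1 + b - a) * (1 + Real.exp x * (1 + x)) := by rw [hx]; ring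

/-- A priori bound: solutions of an equation with linear growth stay in the ball. -/
theorem solution_mem_closedBall {a b K : ℝ} (hab : a ≤ b) (hK : 0 < K) {d : ℕ} {η : Vec d}
    (hη : ‖η‖ ≤ K) {z z' : ℝ → Vec d} (ha : z a = η)
    (hz : ∀ t ∈ Icc a b, HasDerivWithinAt z (z' t) (Icc a b) t)
    (hbound : ∀ t ∈ Icc a b, ‖z' t‖ ≤ K * (1 + ‖η‖ + ‖z t - η‖)) :
    ∀ t ∈ Icc a b, z t ∈ Metric.closedBall η (radius a b K) := by
  intro t ht
  rw [mem_closedBall_iff_norm]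
  refine le_trans ?_ (gronwallBound_le_radius hab hK ht.2)
  refine norm_le_gronwallBound_of_norm_deriv_right_le (f := fun t => z t - η) (f' := z') (b := b)
    ?_ ?_ (by simp [ha]) ?_ t ht
  · exact ContinuousOn.sub (fun s hs => (hz s hs).continuousWithinAt) continuousOn_const
  · intro s hs
    exact ((hz s (Ico_subset_Icc_self hs)).mono_of_mem_nhdsWithin
      (Icc_mem_nhdsGE_of_mem hs)).sub_const η
  · intro s hs
    refine (hbound s (Ico_subset_Icc_self hs)).trans ?_
    nlinarith

variable {a b K L ϱ : ℝ} {d : ℕ} {η : Vec d} {f : ℝ → Vec d → Vec d}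

theorem InClass.mem_closedBall (hF : InClass a b d ϱ K L η f) (hab : a ≤ b) (hK : 0 < K)
    {y : ℝ → Vec d} (hy : IsSolution a b η f y) :
    ∀ t ∈ Icc a b, y t ∈ Metric.closedBall η (radius a b K) := by
  refine solution_mem_closedBall hab hK hF.norm_init_le hy.1 hy.2 fun t ht => ?_
  refine (hF.linear_growth t ht _).trans ?_
  rw [add_assoc]
  gcongr
  simpa using norm_add_le η (y t - η)

theorem InClass.continuousOn_time (hF : InClass a b d ϱ K L η f) (x : Vec d) :
    ContinuousOn (fun t => f t x) (Icc a b) :=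
  hF.continuousOn.comp (f := fun t => (t, x)) (by fun_prop) fun _ ht => ⟨ht, mem_univ _⟩

/-- Precomposing f with the retraction makes it bounded and globally Lipschitz in space. The
retraction does not increase the distance to η, so the a priori bound holds for the truncated
equation too; its solution never leaves the ball and solves the original one. -/
theorem InClass.exists_solution (hF : InClass a b d ϱ K L η f) (hab : a ≤ b) (hK : 0 < K)
    (hL : 0 < L) : ∃ z, IsSolution a b η f z := by
  have hR := radius_pos hab hK
  set R := radius a b K
  have hnorm : ∀ x : Vec d, ‖ballRetraction η R x‖ ≤ ‖η‖ + ‖ballRetraction η R x - η‖ :=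
    fun x => by simpa using norm_add_le η (ballRetraction η R x - η)
  obtain ⟨z, hza, hz⟩ := exists_solution_of_bounded_lipschitz (E := Vec d) hab
    (g := fun t x => f t (ballRetraction η R x)) (M := K * (1 + (‖η‖ + R))) (Λ := L * 2)
    (by positivity) (by positivity) η (fun x => hF.continuousOn_time _)
    (fun t ht x => (hF.linear_growth t ht _).trans (by
      gcongr
      refine (hnorm x).trans ?_
      gcongr
      exact mem_closedBall_iff_norm.1 (ballRetraction_mem hR x)))
    (fun t ht x y => (hF.lipschitz_space t ht _ (ballRetraction_mem hR x) _
      (ballRetraction_mem hR y)).trans (by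
        rw [mul_assoc]
        gcongr
        exact norm_ballRetraction_sub_ballRetraction_le hR x y))
  have hmem := solution_mem_closedBall hab hK hF.norm_init_le hza hz fun t ht => by
    refine (hF.linear_growth t ht _).trans ?_
    rw [add_assoc]
    gcongr
    exact (hnorm _).trans (by gcongr; exact norm_ballRetraction_sub_le hR _)
  refine ⟨z, hza, fun t ht => ?_⟩
  have h := hz t ht
  rwa [ballRetraction_of_mem hR (hmem t ht)] at h

theorem InClass.eqOn_solution (hF : InClass a b d ϱ K L η f) (hab : a ≤ b) (hK : 0 < K)
    (hL : 0 < L) {y z : ℝ → Vec d} (hy : IsSolution a b η f y) (hz : IsSolution a b η f z) :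
    EqOn y z (Icc a b) := by
  have hr : ∀ {w : ℝ → Vec d}, IsSolution a b η f w → ∀ t ∈ Ico a b,
      HasDerivWithinAt w (f t (w t)) (Ici t) t := fun hw t ht =>
    (hw.2 t (Ico_subset_Icc_self ht)).mono_of_mem_nhdsWithin (Icc_mem_nhdsGE_of_mem ht)
  exact ODE_solution_unique_of_mem_Icc_right (K := ⟨L, hL.le⟩) (v := f)
    (s := fun _ => Metric.closedBall η (radius a b K))
    (fun t ht => LipschitzOnWith.of_dist_le_mul fun x hx y hy => by
      simpa only [dist_eq_norm, NNReal.coe_mk] using!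
        hF.lipschitz_space t (Ico_subset_Icc_self ht) x hx y hy)
    (fun s hs => (hy.2 s hs).continuousWithinAt) (hr hy)
    (fun t ht => hF.mem_closedBall hab hK hy t (Ico_subset_Icc_self ht))
    (fun s hs => (hz.2 s hs).continuousWithinAt) (hr hz)
    (fun t ht => hF.mem_closedBall hab hK hz t (Ico_subset_Icc_self ht))
    (hy.1.trans hz.1.symm)

/-! ### Maximal inequality for sums of bounded centred independent variables -/

/-- One step of the pathwise form of Doob's `L²` inequality. -/
theorem two_mul_max_mul_sub_sq_ge (m y y' : ℝ) :
    2 * m * y - m ^ 2 + 2 * m * (y' - y) ≤ 2 * max m y' * y' - max m y' ^ 2 := by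
  rcases le_total m y' with h | h
  · rw [max_eq_right h]; nlinarith [sq_nonneg (y' - m)]
  · rw [max_eq_left h]; nlinarith

theorem rpow_le_mul_exp {p x : ℝ} (hp : 0 < p) (hx : 0 ≤ x) :
    x ^ p ≤ p ^ p * Real.exp x := by
  have h1 : x ≤ p * Real.exp (x / p) := by
    have := Real.add_one_le_exp (x / p)
    calc x = p * (x / p) := by field_simp
      _ ≤ p * Real.exp (x / p) := by gcongr; linarith
  calc x ^ p ≤ (p * Real.exp (x / p)) ^ p := by gcongr
    _ = p ^ p * Real.exp x := by
      rw [Real.mul_rpow hp.le (Real.exp_pos _).le, ← Real.exp_mul]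
      congr 2; field_simp

section Maximal

variable {Ω : Type*} {ξ : ℕ → Ω → ℝ} {c : ℝ}

/-- The exponential of the `k`-th partial sum of `ξ 1, ξ 2, …`. -/
noncomputable def expSum (ξ : ℕ → Ω → ℝ) (k : ℕ) (ω : Ω) : ℝ :=
  Real.exp (∑ i ∈ Finset.range k, ξ (i + 1) ω)

/-- The running maximum of `expSum`. -/
noncomputable def expSumMax (ξ : ℕ → Ω → ℝ) (k : ℕ) (ω : Ω) : ℝ :=
  partialSups (fun j => expSum ξ j ω) k

theorem expSum_succ (ξ : ℕ → Ω → ℝ) (k : ℕ) (ω : Ω) :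
    expSum ξ (k + 1) ω = expSum ξ k ω * Real.exp (ξ (k + 1) ω) := by
  rw [expSum, Finset.sum_range_succ, Real.exp_add]; rfl

theorem expSumMax_succ (ξ : ℕ → Ω → ℝ) (k : ℕ) (ω : Ω) :
    expSumMax ξ (k + 1) ω = max (expSumMax ξ k ω) (expSum ξ (k + 1) ω) :=
  partialSups_add_one _ k

theorem expSum_le_expSumMax (ξ : ℕ → Ω → ℝ) {j k : ℕ} (hjk : j ≤ k) (ω : Ω) :
    expSum ξ j ω ≤ expSumMax ξ k ω :=
  le_partialSups_of_le (fun j => expSum ξ j ω) hjk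

theorem expSum_pos (ξ : ℕ → Ω → ℝ) (k : ℕ) (ω : Ω) : 0 < expSum ξ k ω := Real.exp_pos _

theorem expSumMax_pos (ξ : ℕ → Ω → ℝ) (k : ℕ) (ω : Ω) : 0 < expSumMax ξ k ω :=
  (expSum_pos ξ k ω).trans_le (expSum_le_expSumMax ξ le_rfl ω)

theorem expSum_le (hc : ∀ i ω, |ξ i ω| ≤ c) (k : ℕ) (ω : Ω) :
    expSum ξ k ω ≤ Real.exp (k * c) := by
  refine Real.exp_le_exp.2 ((Finset.sum_le_card_nsmul _ _ c fun i _ =>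
    (le_abs_self _).trans (hc _ _)).trans_eq (by simp))

theorem expSumMax_le (hc0 : 0 ≤ c) (hc : ∀ i ω, |ξ i ω| ≤ c) (k : ℕ) (ω : Ω) :
    expSumMax ξ k ω ≤ Real.exp (k * c) := by
  refine partialSups_le _ _ _ fun j hj => (expSum_le hc j ω).trans ?_
  gcongr

theorem measurable_expSum_of {m : MeasurableSpace Ω} {k : ℕ}
    (h : ∀ i ≤ k, Measurable[m] (ξ i)) : Measurable[m] (expSum ξ k) := by
  unfold expSum
  refine Real.measurable_exp.comp (Finset.measurable_fun_sum _ fun i hi => h _ ?_)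
  exact Finset.mem_range.1 hi

theorem measurable_expSumMax_of {m : MeasurableSpace Ω} {k : ℕ}
    (h : ∀ i ≤ k, Measurable[m] (ξ i)) : Measurable[m] (expSumMax ξ k) := by
  induction k with
  | zero =>
    have : expSumMax ξ 0 = expSum ξ 0 := rfl
    rw [this]; exact measurable_expSum_of h
  | succ k ih =>
    have : expSumMax ξ (k + 1) = fun ω => max (expSumMax ξ k ω) (expSum ξ (k + 1) ω) :=
      funext fun ω => expSumMax_succ ξ k ω
    rw [this]
    exact (ih fun i hi => h i (hi.trans k.le_succ)).max (measurable_expSum_of h)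

variable [MeasurableSpace Ω] {P : Measure Ω} [IsProbabilityMeasure P]

theorem integrable_of_measurable_of_abs_le {X : Ω → ℝ} (hX : Measurable X) (C : ℝ)
    (h : ∀ ω, |X ω| ≤ C) : Integrable X P :=
  Integrable.of_bound hX.aestronglyMeasurable C (ae_of_all _ h)

/-- The increment of the exponential walk is `expSum ξ k` times e^{ξ_{k+1}} − 1. The second factor
is independent of the past and has nonnegative mean because e^x − 1 ≥ x. -/
theorem integral_expSumMax_mul_sub_nonneg (hm : ∀ i, Measurable (ξ i)) (hind : iIndepFun ξ P)
    (hmean : ∀ i, ∫ ω, ξ i ω ∂P = 0) (hc : ∀ i ω, |ξ i ω| ≤ c)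
    (k : ℕ) :
    0 ≤ ∫ ω, expSumMax ξ k ω * (expSum ξ (k + 1) ω - expSum ξ k ω) ∂P := by
  have hsm : ∀ i, StronglyMeasurable (ξ i) := fun i => (hm i).stronglyMeasurable
  have hF : ∀ i ≤ k, Measurable[Filtration.natural ξ hsm k] (ξ i) := fun i hi =>
    ((Filtration.stronglyAdapted_natural hsm i).mono
      ((Filtration.natural ξ hsm).mono hi)).measurable
  have hindk : IndepFun (fun ω => expSumMax ξ k ω * expSum ξ k ω)
      (fun ω => Real.exp (ξ (k + 1) ω) - 1) P := by
    have h1 : Indep (Filtration.natural ξ hsm k) (MeasurableSpace.comap (ξ (k + 1)) inferInstance)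
        P := (hind.indep_comap_natural_of_lt hsm k.lt_succ_self).symm
    rw [IndepFun_iff_Indep]
    refine indep_of_indep_of_le_left (indep_of_indep_of_le_right h1 ?_) ?_
    · have : Measurable[MeasurableSpace.comap (ξ (k + 1)) inferInstance]
          (fun ω => Real.exp (ξ (k + 1) ω) - 1) :=
        (Real.measurable_exp.sub_const 1).comp (comap_measurable _)
      exact this.comap_le
    · exact ((measurable_expSumMax_of hF).mul (measurable_expSum_of hF)).comap_le
  have hmeas1 : Measurable (fun ω => expSumMax ξ k ω * expSum ξ k ω) :=
    (measurable_expSumMax_of fun i _ => hm i).mul (measurable_expSum_of fun i _ => hm i)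
  have hmeas2 : Measurable (fun ω => Real.exp (ξ (k + 1) ω) - 1) := by
    have := hm (k + 1); fun_prop
  have hint : Integrable (fun ω => Real.exp (ξ (k + 1) ω) - 1) P := by
    refine integrable_of_measurable_of_abs_le hmeas2 (Real.exp c + 1) fun ω => ?_
    have := Real.exp_le_exp.2 ((le_abs_self _).trans (hc (k + 1) ω))
    have h0 := Real.exp_pos (ξ (k + 1) ω)
    rw [abs_le]; constructor <;> linarith [Real.exp_pos c]
  have hξint : Integrable (ξ (k + 1)) P := integrable_of_measurable_of_abs_le (hm _) c (hc _)
  have h2 : ∫ ω, expSumMax ξ k ω * (expSum ξ (k + 1) ω - expSum ξ k ω) ∂P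
      = (∫ ω, expSumMax ξ k ω * expSum ξ k ω ∂P) * ∫ ω, (Real.exp (ξ (k + 1) ω) - 1) ∂P := by
    rw [← hindk.integral_fun_mul_eq_mul_integral hmeas1.aestronglyMeasurable
      hmeas2.aestronglyMeasurable]
    refine integral_congr_ae (ae_of_all _ fun ω => ?_)
    simp only [expSum_succ]
    ring
  rw [h2]
  refine mul_nonneg (integral_nonneg fun ω => ?_) ?_
  · exact (mul_pos (expSumMax_pos _ _ _) (expSum_pos _ _ _)).le
  · rw [← hmean (k + 1)]
    refine integral_mono hξint hint fun ω => ?_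
    linarith [Real.add_one_le_exp (ξ (k + 1) ω)]

/-- Doob's `L²` inequality for the exponential of a random walk with bounded centred steps. -/
theorem integral_expSumMax_sq_le (hm : ∀ i, Measurable (ξ i)) (hind : iIndepFun ξ P)
    (hmean : ∀ i, ∫ ω, ξ i ω ∂P = 0) (hc0 : 0 ≤ c) (hc : ∀ i ω, |ξ i ω| ≤ c)
    (n : ℕ) :
    ∫ ω, expSumMax ξ n ω ^ 2 ∂P ≤ 4 * ∫ ω, expSum ξ n ω ^ 2 ∂P := by
  have hmm : ∀ k, Measurable (expSumMax ξ k) := fun k => measurable_expSumMax_of fun i _ => hm i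
  have hmy : ∀ k, Measurable (expSum ξ k) := fun k => measurable_expSum_of fun i _ => hm i
  have hbm : ∀ k ω, |expSumMax ξ k ω| ≤ Real.exp (k * c) := fun k ω => by
    rw [abs_of_pos (expSumMax_pos _ _ _)]; exact expSumMax_le hc0 hc k ω
  have hby : ∀ k ω, |expSum ξ k ω| ≤ Real.exp (k * c) := fun k ω => by
    rw [abs_of_pos (expSum_pos _ _ _)]; exact expSum_le hc k ω
  have imm : ∀ k, Integrable (fun ω => expSumMax ξ k ω ^ 2) P := fun k =>
    integrable_of_measurable_of_abs_le ((hmm k).pow_const 2) (Real.exp (k * c) ^ 2) fun ω => by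
      rw [abs_pow]; gcongr; exact hbm k ω
  have iyy : ∀ k, Integrable (fun ω => expSum ξ k ω ^ 2) P := fun k =>
    integrable_of_measurable_of_abs_le ((hmy k).pow_const 2) (Real.exp (k * c) ^ 2) fun ω => by
      rw [abs_pow]; gcongr; exact hby k ω
  have imy : ∀ k l, Integrable (fun ω => expSumMax ξ k ω * expSum ξ l ω) P := fun k l =>
    integrable_of_measurable_of_abs_le ((hmm k).mul (hmy l)) (Real.exp (k * c) * Real.exp (l * c))
      fun ω => by rw [abs_mul]; gcongr; exacts [hbm k ω, hby l ω]
  have iΦ : ∀ k, Integrable (fun ω => 2 * (expSumMax ξ k ω * expSum ξ k ω) - expSumMax ξ k ω ^ 2)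
      P := fun k => ((imy k k).const_mul 2).sub (imm k)
  -- Writing m for the running maximum and y for the walk, 2my − m² has nonnegative mean: it starts
  -- at y² and each step adds at least 2m(y' − y), whose mean is nonnegative.
  have hΦ : ∀ k, 0 ≤ ∫ ω, (2 * (expSumMax ξ k ω * expSum ξ k ω) - expSumMax ξ k ω ^ 2) ∂P := by
    intro k
    induction k with
    | zero =>
      refine integral_nonneg fun ω => ?_
      have : expSumMax ξ 0 ω = expSum ξ 0 ω := rfl
      simp only [Pi.zero_apply, this]
      nlinarith [sq_nonneg (expSum ξ 0 ω)]
    | succ k ih =>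
      have hinc := integral_expSumMax_mul_sub_nonneg hm hind hmean hc k
      have iinc : Integrable
          (fun ω => expSumMax ξ k ω * (expSum ξ (k + 1) ω - expSum ξ k ω)) P := by
        simp only [mul_sub]; exact (imy k (k + 1)).sub (imy k k)
      calc (0 : ℝ) ≤ (∫ ω, (2 * (expSumMax ξ k ω * expSum ξ k ω) - expSumMax ξ k ω ^ 2) ∂P)
            + 2 * ∫ ω, expSumMax ξ k ω * (expSum ξ (k + 1) ω - expSum ξ k ω) ∂P := by positivity
        _ = ∫ ω, (2 * (expSumMax ξ k ω * expSum ξ k ω) - expSumMax ξ k ω ^ 2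
            + 2 * (expSumMax ξ k ω * (expSum ξ (k + 1) ω - expSum ξ k ω))) ∂P := by
          rw [integral_add (iΦ k) (iinc.const_mul 2), integral_const_mul]
        _ ≤ _ := by
          refine integral_mono ((iΦ k).add (iinc.const_mul 2)) (iΦ (k + 1)) fun ω => ?_
          have := two_mul_max_mul_sub_sq_ge (expSumMax ξ k ω) (expSum ξ k ω) (expSum ξ (k + 1) ω)
          simp only [expSumMax_succ]
          linarith
  -- Pointwise 2my − m² ≤ 2y² − m²/2, which is (m − 2y)² ≥ 0. With the preceding sign this gives the
  -- constant 4.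
  have h1 : ∫ ω, (2 * (expSumMax ξ n ω * expSum ξ n ω) - expSumMax ξ n ω ^ 2) ∂P
      ≤ ∫ ω, (2 * expSum ξ n ω ^ 2 - 1 / 2 * expSumMax ξ n ω ^ 2) ∂P := by
    refine integral_mono (iΦ n) (((iyy n).const_mul 2).sub ((imm n).const_mul _)) fun ω => ?_
    dsimp only
    nlinarith [sq_nonneg (expSumMax ξ n ω - 2 * expSum ξ n ω)]
  rw [integral_sub ((iyy n).const_mul 2) ((imm n).const_mul _), integral_const_mul,
    integral_const_mul] at h1
  linarith [hΦ n]

/-- By Hoeffding's lemma a centred variable with values in [−c, c] is sub-Gaussian with variance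
proxy c². Independence adds the proxies, and the second moment is the moment generating function of
the sum at 2. -/
theorem integral_expSum_sq_le (hm : ∀ i, Measurable (ξ i)) (hind : iIndepFun ξ P)
    (hmean : ∀ i, ∫ ω, ξ i ω ∂P = 0) (hc0 : 0 ≤ c) (hc : ∀ i ω, |ξ i ω| ≤ c)
    (n : ℕ) :
    ∫ ω, expSum ξ n ω ^ 2 ∂P ≤ Real.exp (2 * (n * c ^ 2)) := by
  have hsub : ∀ i, HasSubgaussianMGF (ξ i) (c ^ 2).toNNReal P := fun i => by
    have := hasSubgaussianMGF_of_mem_Icc_of_integral_eq_zero (a := -c) (b := c)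
      (hm i).aemeasurable (ae_of_all P fun ω => abs_le.1 (hc i ω)) (hmean i)
    convert! this using 1
    ext
    simp only [Real.coe_toNNReal _ (sq_nonneg c), NNReal.coe_pow, NNReal.coe_div, NNReal.coe_ofNat,
      coe_nnnorm, Real.norm_eq_abs]
    rw [sub_neg_eq_add, abs_of_nonneg (by linarith)]
    ring
  have hsum := HasSubgaussianMGF.sum_of_iIndepFun
    (X := fun i => ξ (i + 1)) (hind.precomp (g := fun i => i + 1) (add_left_injective 1))
    (c := fun _ => (c ^ 2).toNNReal) (s := Finset.range n) fun i _ => hsub (i + 1)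
  have := hsum.mgf_le 2
  refine le_trans (le_of_eq ?_) (this.trans_eq ?_)
  · rw [mgf]
    refine integral_congr_ae (ae_of_all _ fun ω => ?_)
    simp only [expSum, ← Real.exp_nat_mul, Nat.cast_ofNat]
  · simp only [Finset.sum_const, Finset.card_range, nsmul_eq_mul, NNReal.coe_mul,
      NNReal.coe_natCast, Real.coe_toNNReal _ (sq_nonneg c)]
    congr 1
    ring

/-- The `L^p` norm of the maximal partial sum of bounded centred independent random variables. -/
theorem eLpNorm_partialSups_abs_sum_le (hm : ∀ i, Measurable (ξ i)) (hind : iIndepFun ξ P)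
    (hmean : ∀ i, ∫ ω, ξ i ω ∂P = 0) (hc : ∀ i ω, |ξ i ω| ≤ c)
    {p : ℝ} (hp : 0 < p) {n : ℕ} (hn : 0 < n) (hcpos : 0 < c) :
    eLpNorm (fun ω => partialSups (fun k => |∑ i ∈ Finset.range k, ξ (i + 1) ω|) n)
      (ENNReal.ofReal p) P
      ≤ ENNReal.ofReal ((p ^ p * (8 * Real.exp 2)) ^ (1 / p) * (c * √n)) := by
  have hn' : (0 : ℝ) < n := by exact_mod_cast hn
  set s := c * √n with hs
  have hs0 : 0 < s := by positivity
  -- Rescaled by s = c√n, the steps are bounded by n^{−1/2}, so the second moment bound is e² for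
  -- every n. Both signs are needed because the absolute value of the walk is maximized.
  have key : ∀ σ : ℝ, |σ| = 1 →
      Integrable (fun ω => expSumMax (fun i ω => σ * s⁻¹ * ξ i ω) n ω ^ 2) P ∧
      ∫ ω, expSumMax (fun i ω => σ * s⁻¹ * ξ i ω) n ω ^ 2 ∂P ≤ 4 * Real.exp 2 := by
    intro σ hσ
    have hm' : ∀ i, Measurable (fun ω => σ * s⁻¹ * ξ i ω) := fun i => (hm i).const_mul _
    have hind' : iIndepFun (fun i ω => σ * s⁻¹ * ξ i ω) P :=
      hind.comp (fun _ x => σ * s⁻¹ * x) fun _ => measurable_const_mul _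
    have hmean' : ∀ i, ∫ ω, σ * s⁻¹ * ξ i ω ∂P = 0 := fun i => by
      rw [integral_const_mul, hmean, mul_zero]
    have hc' : ∀ i ω, |σ * s⁻¹ * ξ i ω| ≤ (√n)⁻¹ := fun i ω => by
      rw [abs_mul, abs_mul, hσ, one_mul, abs_of_pos (inv_pos.2 hs0)]
      calc s⁻¹ * |ξ i ω| ≤ s⁻¹ * c := by gcongr; exact hc i ω
        _ = (√n)⁻¹ := by rw [hs]; field_simp
    have hc0' : 0 ≤ (√(n : ℝ))⁻¹ := by positivity
    have hmax := measurable_expSumMax_of (k := n) fun i _ => hm' i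
    refine ⟨integrable_of_measurable_of_abs_le (hmax.pow_const 2)
      (Real.exp (n * (√n)⁻¹) ^ 2) fun ω => ?_, ?_⟩
    · rw [abs_pow, abs_of_pos (expSumMax_pos _ _ _)]
      have := (expSumMax_pos (fun i ω => σ * s⁻¹ * ξ i ω) n ω).le
      gcongr
      exact expSumMax_le hc0' hc' n ω
    · refine (integral_expSumMax_sq_le hm' hind' hmean' hc0' hc' n).trans ?_
      gcongr
      refine (integral_expSum_sq_le hm' hind' hmean' hc0' hc' n).trans_eq ?_
      congr 1
      rw [inv_pow, Real.sq_sqrt hn'.le, mul_inv_cancel₀ hn'.ne', mul_one]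
  obtain ⟨i1, b1⟩ := key 1 (by simp)
  obtain ⟨i2, b2⟩ := key (-1) (by simp)
  set A : Ω → ℝ := fun ω => partialSups (fun k => |∑ i ∈ Finset.range k, ξ (i + 1) ω|) n
  set m1 := expSumMax (fun i ω => 1 * s⁻¹ * ξ i ω) n
  set m2 := expSumMax (fun i ω => -1 * s⁻¹ * ξ i ω) n
  have hA0 : ∀ ω, 0 ≤ A ω := fun ω => (abs_nonneg _).trans
    (le_partialSups (fun k => |∑ i ∈ Finset.range k, ξ (i + 1) ω|) n)
  -- The maximum is attained at some k with one of the two signs, so one exponential maximum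
  -- dominates e^{A/s}. As e^{A/s} ≥ 1, its square does too, and the square is what Doob's
  -- inequality controls.
  have hexp : ∀ ω, Real.exp (A ω / s) ≤ m1 ω ^ 2 + m2 ω ^ 2 := by
    intro ω
    obtain ⟨k, hk, hAk⟩ : ∃ k ≤ n, A ω = |∑ i ∈ Finset.range k, ξ (i + 1) ω| :=
      exists_partialSups_eq (fun k => |∑ i ∈ Finset.range k, ξ (i + 1) ω|) n
    have hcase : ∀ σ : ℝ, A ω = σ * ∑ i ∈ Finset.range k, ξ (i + 1) ω →
        Real.exp (A ω / s) ≤ expSumMax (fun i ω => σ * s⁻¹ * ξ i ω) n ω ^ 2 := by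
      intro σ hσ
      have h1 : Real.exp (A ω / s) ≤ expSumMax (fun i ω => σ * s⁻¹ * ξ i ω) n ω := by
        refine le_trans (le_of_eq ?_) (expSum_le_expSumMax _ hk ω)
        rw [expSum, ← Finset.mul_sum, hσ]
        congr 1; ring
      have h2 : 1 ≤ Real.exp (A ω / s) := Real.one_le_exp (div_nonneg (hA0 ω) hs0.le)
      nlinarith
    rcases abs_choice (∑ i ∈ Finset.range k, ξ (i + 1) ω) with h | h
    · have := hcase 1 (by rw [hAk, h, one_mul])
      nlinarith [sq_nonneg (m2 ω)]
    · have := hcase (-1) (by rw [hAk, h, neg_one_mul])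
      nlinarith [sq_nonneg (m1 ω)]
  have hpt : ∀ ω, A ω ^ p ≤ s ^ p * p ^ p * (m1 ω ^ 2 + m2 ω ^ 2) := by
    intro ω
    have h1 := rpow_le_mul_exp hp (div_nonneg (hA0 ω) hs0.le)
    rw [Real.div_rpow (hA0 ω) hs0.le, div_le_iff₀ (by positivity)] at h1
    calc A ω ^ p ≤ p ^ p * Real.exp (A ω / s) * s ^ p := h1
      _ ≤ p ^ p * (m1 ω ^ 2 + m2 ω ^ 2) * s ^ p := by gcongr; exact hexp ω
      _ = _ := by ring
  have hp0 : ENNReal.ofReal p ≠ 0 := by simpa using hp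
  rw [eLpNorm_eq_lintegral_rpow_enorm_toReal hp0 ENNReal.ofReal_ne_top, ENNReal.toReal_ofReal hp.le]
  have hint : ∫⁻ ω, ‖A ω‖ₑ ^ p ∂P ≤ ENNReal.ofReal (s ^ p * (p ^ p * (8 * Real.exp 2))) := by
    calc ∫⁻ ω, ‖A ω‖ₑ ^ p ∂P
        ≤ ∫⁻ ω, ENNReal.ofReal (s ^ p * p ^ p * (m1 ω ^ 2 + m2 ω ^ 2)) ∂P := by
          refine lintegral_mono fun ω => ?_
          rw [Real.enorm_of_nonneg (hA0 ω), ENNReal.ofReal_rpow_of_nonneg (hA0 ω) hp.le]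
          exact ENNReal.ofReal_le_ofReal (hpt ω)
      _ = ENNReal.ofReal (∫ ω, s ^ p * p ^ p * (m1 ω ^ 2 + m2 ω ^ 2) ∂P) := by
          exact (ofReal_integral_eq_lintegral_ofReal ((i1.add i2).const_mul _)
            (ae_of_all _ fun ω => by simp only [Pi.zero_apply, Pi.add_apply]; positivity)).symm
      _ ≤ _ := by
          refine ENNReal.ofReal_le_ofReal ?_
          rw [integral_const_mul, integral_add i1 i2, mul_assoc]
          gcongr
          linarith
  calc (∫⁻ ω, ‖A ω‖ₑ ^ p ∂P) ^ (1 / p)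
      ≤ ENNReal.ofReal (s ^ p * (p ^ p * (8 * Real.exp 2))) ^ (1 / p) := by gcongr
    _ = _ := by
      rw [ENNReal.ofReal_rpow_of_nonneg (by positivity) (by positivity),
        Real.mul_rpow (by positivity) (by positivity), ← Real.rpow_mul hs0.le,
        mul_one_div_cancel hp.ne', Real.rpow_one, mul_comm]

end Maximal

/-! ### Elementary facts on the grid -/

section Grid

variable {a b : ℝ} {n : ℕ}

theorem step_pos (hab : a < b) (hn : 0 < n) : 0 < step a b n :=
  div_pos (sub_pos.2 hab) (Nat.cast_pos.2 hn)

theorem natCast_mul_step (hn : 0 < n) : (n : ℝ) * step a b n = b - a := by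
  have : (n : ℝ) ≠ 0 := Nat.cast_ne_zero.2 hn.ne'
  rw [step]; field_simp

theorem grid_zero : grid a b n 0 = a := by simp [grid]

theorem grid_succ (j : ℕ) : grid a b n (j + 1) = grid a b n j + step a b n := by
  simp only [grid]; push_cast; ring

theorem grid_mem_Icc (hab : a < b) (hn : 0 < n) {j : ℕ} (hj : j ≤ n) :
    grid a b n j ∈ Icc a b := by
  have hh := step_pos hab hn
  have hj' : (j : ℝ) ≤ n := Nat.cast_le.2 hj
  have h1 : (j : ℝ) * step a b n ≤ n * step a b n := by gcongr
  rw [natCast_mul_step hn] at h1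
  have h0 : 0 ≤ (j : ℝ) * step a b n := by positivity
  constructor <;> simp only [grid] <;> linarith

theorem grid_add_mem_Icc (hab : a < b) (hn : 0 < n) {j : ℕ} (hj : j < n) {x : ℝ}
    (hx : x ∈ Icc (0 : ℝ) 1) : grid a b n j + x * step a b n ∈ Icc a b := by
  have hh := step_pos hab hn
  have h1 := (grid_mem_Icc hab hn hj.le).1
  have h2 := (grid_mem_Icc hab hn (Nat.succ_le_of_lt hj)).2
  rw [grid_succ] at h2
  constructor
  · nlinarith [mul_nonneg hx.1 hh.le]
  · nlinarith [mul_le_mul_of_nonneg_right hx.2 hh.le]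

theorem exists_mem_Icc_grid (hab : a < b) (hn : 0 < n) {t : ℝ} (ht : t ∈ Icc a b) :
    ∃ j < n, t ∈ Icc (grid a b n j) (grid a b n (j + 1)) := by
  have hh := step_pos hab hn
  have hq0 : 0 ≤ (t - a) / step a b n := div_nonneg (sub_nonneg.2 ht.1) hh.le
  have hmul : (t - a) / step a b n * step a b n = t - a := div_mul_cancel₀ _ hh.ne'
  rcases lt_or_ge ⌊(t - a) / step a b n⌋₊ n with h | h
  · refine ⟨_, h, ?_, ?_⟩
    · have := mul_le_mul_of_nonneg_right (Nat.floor_le hq0) hh.le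
      rw [hmul] at this; simp only [grid]; linarith
    · have := mul_le_mul_of_nonneg_right (Nat.lt_floor_add_one ((t - a) / step a b n)).le hh.le
      rw [hmul] at this; simp only [grid]; push_cast; linarith
  · have h1 : (n : ℝ) ≤ (t - a) / step a b n := (Nat.le_floor_iff hq0).1 h
    have h2 := mul_le_mul_of_nonneg_right h1 hh.le
    rw [hmul, natCast_mul_step hn] at h2
    have htb : t = b := le_antisymm ht.2 (by linarith)
    refine ⟨n - 1, by omega, ?_⟩
    have hb : grid a b n (n - 1 + 1) = b := by
      rw [Nat.sub_add_cancel hn, grid, natCast_mul_step hn]; ring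
    have hs := grid_succ (a := a) (b := b) (n := n) (n - 1)
    rw [hb] at hs ⊢
    constructor <;> linarith

end Grid

/-! ### Time regularity of the exact solution -/

section Solution

variable {a b K L ϱ : ℝ} {d : ℕ} {η : Vec d} {f : ℝ → Vec d → Vec d} {z : ℝ → Vec d}

/-- A bound for the derivative of the solution. -/
noncomputable def slopeBound (a b K : ℝ) : ℝ := K * (1 + (K + radius a b K))

/-- A Hölder constant for the derivative of the solution. -/
noncomputable def slopeHolder (a b K L : ℝ) : ℝ := L * (1 + slopeBound a b K)

theorem slopeBound_pos (hab : a ≤ b) (hK : 0 < K) : 0 < slopeBound a b K := by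
  have := radius_pos hab hK
  unfold slopeBound
  positivity

theorem slopeHolder_pos (hab : a ≤ b) (hK : 0 < K) (hL : 0 < L) : 0 < slopeHolder a b K L := by
  have := slopeBound_pos hab hK
  unfold slopeHolder
  positivity

theorem InClass.norm_slope_le (hF : InClass a b d ϱ K L η f) (hab : a ≤ b) (hK : 0 < K)
    (hz : IsSolution a b η f z) {t : ℝ} (ht : t ∈ Icc a b) : ‖f t (z t)‖ ≤ slopeBound a b K := by
  have hmem := mem_closedBall_iff_norm.1 (hF.mem_closedBall hab hK hz t ht)
  refine (hF.linear_growth t ht _).trans ?_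
  unfold slopeBound
  gcongr
  have : ‖z t‖ ≤ ‖η‖ + ‖z t - η‖ := by simpa using norm_add_le η (z t - η)
  linarith [hF.norm_init_le]

/-- Hölder continuity in time is combined with the Lipschitz continuity of z; the Lipschitz part is
absorbed by h ≤ h^ϱ, which is where h ≤ 1 enters. -/
theorem InClass.norm_slope_sub_le (hF : InClass a b d ϱ K L η f) (hab : a ≤ b) (hϱ0 : 0 < ϱ)
    (hϱ1 : ϱ ≤ 1) (hK : 0 < K) (hL : 0 < L) (hz : IsSolution a b η f z) {s t h : ℝ}
    (hs : s ∈ Icc a b) (ht : t ∈ Icc a b) (hst : |t - s| ≤ h) (h1 : h ≤ 1) :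
    ‖f t (z t) - f s (z s)‖ ≤ slopeHolder a b K L * h ^ ϱ := by
  have hM := slopeBound_pos hab hK
  have h0 : 0 ≤ h := (abs_nonneg _).trans hst
  have hball := hF.mem_closedBall hab hK hz
  have hlip : ‖z t - z s‖ ≤ slopeBound a b K * ‖t - s‖ :=
    (convex_Icc a b).norm_image_sub_le_of_norm_hasDerivWithin_le hz.2
      (fun u hu => hF.norm_slope_le hab hK hz hu) hs ht
  rw [Real.norm_eq_abs] at hlip
  have hpow : |t - s| ^ ϱ ≤ h ^ ϱ := Real.rpow_le_rpow (abs_nonneg _) hst hϱ0.le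
  have hh : h ≤ h ^ ϱ := by
    rcases h0.eq_or_lt with rfl | hpos
    · exact Real.rpow_nonneg le_rfl _
    · simpa using Real.rpow_le_rpow_of_exponent_ge hpos h1 hϱ1
  calc ‖f t (z t) - f s (z s)‖
      ≤ ‖f t (z t) - f s (z t)‖ + ‖f s (z t) - f s (z s)‖ := norm_sub_le_norm_sub_add_norm_sub ..
    _ ≤ L * |t - s| ^ ϱ + L * ‖z t - z s‖ :=
        add_le_add (hF.holder_time t ht s hs _ (hball t ht))
          (hF.lipschitz_space s hs _ (hball t ht) _ (hball s hs))
    _ ≤ L * h ^ ϱ + L * (slopeBound a b K * h ^ ϱ) := by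
        gcongr
        exact hlip.trans (by gcongr; exact hst.trans hh)
    _ = slopeHolder a b K L * h ^ ϱ := by unfold slopeHolder; ring

/-- First-order Taylor remainder: the derivative of u ↦ z(u) − (u − s) f(s, z(s)) is a difference of
slopes, hence O(h^ϱ). -/
theorem InClass.norm_sub_sub_smul_slope_le (hF : InClass a b d ϱ K L η f) (hab : a ≤ b)
    (hϱ0 : 0 < ϱ) (hϱ1 : ϱ ≤ 1) (hK : 0 < K) (hL : 0 < L) (hz : IsSolution a b η f z) {s t h : ℝ}
    (hs : s ∈ Icc a b) (ht : t ∈ Icc a b) (hst : s ≤ t) (hsth : t - s ≤ h) (h1 : h ≤ 1) :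
    ‖z t - z s - (t - s) • f s (z s)‖ ≤ slopeHolder a b K L * h ^ ϱ * (t - s) := by
  have hsub : Icc s t ⊆ Icc a b := Icc_subset_Icc hs.1 ht.2
  have hderiv : ∀ u ∈ Icc s t, HasDerivWithinAt (fun u => z u - (u - s) • f s (z s))
      (f u (z u) - f s (z s)) (Icc s t) u := fun u hu => by
    have h2 : HasDerivWithinAt (fun u : ℝ => (u - s) • f s (z s)) ((1 : ℝ) • f s (z s))
        (Icc s t) u := (((hasDerivAt_id u).sub_const s).smul_const _).hasDerivWithinAt
    rw [one_smul] at h2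
    exact ((hz.2 u (hsub hu)).mono hsub).sub h2
  have := norm_image_sub_le_of_norm_deriv_le_segment' hderiv
    (fun u hu => hF.norm_slope_sub_le hab hϱ0 hϱ1 hK hL hz hs (hsub (Ico_subset_Icc_self hu))
      (by rw [abs_of_nonneg (by linarith [hu.1])]; linarith [hu.2]) h1) t (right_mem_Icc.2 hst)
  simpa [sub_right_comm] using this

end Solution

/-! ### Pathwise analysis of the scheme: boundedness, local errors, stability -/

section Scheme

variable {a b K L ϱ δ : ℝ} {d n : ℕ} {η η' : Vec d} {f f' : ℝ → Vec d → Vec d} {z : ℝ → Vec d}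
  {τ : ℕ → ℝ}

/-- The intermediate stage `V^{j+1}_τ` of the scheme. -/
noncomputable def rkStage (a b : ℝ) {d : ℕ} (n : ℕ) (η : Vec d) (f : ℝ → Vec d → Vec d)
    (τ : ℕ → ℝ) (j : ℕ) : Vec d :=
  rkValue a b n η f τ j + (step a b n * τ (j + 1)) • f (grid a b n j) (rkValue a b n η f τ j)

theorem rkValue_succ (a b : ℝ) (n : ℕ) (η : Vec d) (f : ℝ → Vec d → Vec d) (τ : ℕ → ℝ) (j : ℕ) :
    rkValue a b n η f τ (j + 1) = rkValue a b n η f τ j + step a b n •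
      f (grid a b n j + τ (j + 1) * step a b n) (rkStage a b n η f τ j) := rfl

theorem IsNoisyData.norm_sub_le (hN : IsNoisyData a b δ η f η' f') {t : ℝ} (ht : t ∈ Icc a b)
    (y : Vec d) : ‖f' t y - f t y‖ ≤ δ := by
  obtain ⟨-, e, he, h⟩ := hN
  rw [h t ht, add_sub_cancel_left]
  exact he.norm_le t ht y

theorem IsNoisyData.norm_le (hN : IsNoisyData a b δ η f η' f') (hF : InClass a b d ϱ K L η f)
    (hδ : δ ≤ 1) {t : ℝ} (ht : t ∈ Icc a b) (y : Vec d) : ‖f' t y‖ ≤ K * (1 + ‖y‖) + 1 := by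
  have h1 := hN.norm_sub_le ht y
  have h2 := hF.linear_growth t ht y
  have h3 := norm_add_le (f t y) (f' t y - f t y)
  rw [add_sub_cancel] at h3
  linarith

theorem norm_rkStage_le (hN : IsNoisyData a b δ η f η' f') (hF : InClass a b d ϱ K L η f)
    (hδ : δ ≤ 1) (hab : a < b) (hτ : ∀ j, τ j ∈ Icc (0 : ℝ) 1) {j : ℕ} (hj : j < n) :
    ‖rkStage a b n η' f' τ j‖ ≤ ‖rkValue a b n η' f' τ j‖
      + step a b n * (K * (1 + ‖rkValue a b n η' f' τ j‖) + 1) := by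
  have hn : 0 < n := (Nat.zero_le j).trans_lt hj
  have hh := step_pos hab hn
  refine (norm_add_le _ _).trans ?_
  have hx := hτ (j + 1)
  rw [norm_smul, Real.norm_eq_abs, abs_of_nonneg (mul_nonneg hh.le hx.1)]
  gcongr
  · exact mul_le_of_le_one_right hh.le hx.2
  · exact hN.norm_le hF hδ (grid_mem_Icc hab hn hj.le) _

/-- The noisy growth bound is K(‖y‖ + 1/K + 1), so shifting the norms by 1/K + 1 turns the affine
recursion into a multiplicative one with factor 1 + hK(1 + hK). The initial value ‖η'‖ ≤ K + 1
becomes (1/K + 1)(1 + K) after the shift. -/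
theorem norm_rkValue_add_le (hN : IsNoisyData a b δ η f η' f') (hF : InClass a b d ϱ K L η f)
    (hδ : δ ≤ 1) (hab : a < b) (hK : 0 < K) (hn : 0 < n) (hτ : ∀ j, τ j ∈ Icc (0 : ℝ) 1)
    {j : ℕ} (hj : j ≤ n) :
    ‖rkValue a b n η' f' τ j‖ + (1 / K + 1) ≤
      (1 / K + 1) * (1 + K) * Real.exp (j * (step a b n * K * (1 + step a b n * K))) := by
  have hh := step_pos hab hn
  have hKK : K * (1 / K) = 1 := by field_simp
  induction j with
  | zero =>
    have h1 : ‖η'‖ ≤ ‖η‖ + ‖η' - η‖ := by simpa using norm_add_le η (η' - η)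
    have h2 := mem_closedBall_iff_norm.1 hN.1
    have h3 := hF.norm_init_le
    simp only [rkValue, Nat.cast_zero, zero_mul, Real.exp_zero, mul_one]
    nlinarith
  | succ j ih =>
    have ih := ih (Nat.le_of_succ_le hj)
    have hst := norm_rkStage_le hN hF hδ hab hτ (Nat.lt_of_succ_le hj)
    have hf := hN.norm_le hF hδ (grid_add_mem_Icc hab hn (Nat.lt_of_succ_le hj) (hτ (j + 1)))
      (rkStage a b n η' f' τ j)
    have hsucc : ‖rkValue a b n η' f' τ (j + 1)‖ ≤ ‖rkValue a b n η' f' τ j‖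
        + step a b n * (K * (1 + ‖rkStage a b n η' f' τ j‖) + 1) := by
      rw [rkValue_succ]
      refine (norm_add_le _ _).trans ?_
      rw [norm_smul, Real.norm_eq_abs, abs_of_pos hh]
      gcongr
    set h := step a b n
    set v := ‖rkValue a b n η' f' τ j‖
    set u := ‖rkStage a b n η' f' τ j‖
    have hu : u + (1 / K + 1) ≤ (1 + h * K) * (v + (1 / K + 1)) := by
      have : h * K * (1 / K) = h := by rw [mul_assoc, hKK, mul_one]
      nlinarith
    calc ‖rkValue a b n η' f' τ (j + 1)‖ + (1 / K + 1)
        ≤ v + h * K * (u + (1 / K + 1)) + (1 / K + 1) := by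
          have : h * K * (1 / K) = h := by rw [mul_assoc, hKK, mul_one]
          nlinarith
      _ ≤ v + h * K * ((1 + h * K) * (v + (1 / K + 1))) + (1 / K + 1) := by gcongr
      _ = (h * K * (1 + h * K) + 1) * (v + (1 / K + 1)) := by ring
      _ ≤ Real.exp (h * K * (1 + h * K)) *
          ((1 / K + 1) * (1 + K) * Real.exp (j * (h * K * (1 + h * K)))) := by
          gcongr
          exact Real.add_one_le_exp _
      _ = _ := by
          push_cast
          rw [add_mul (j : ℝ), one_mul, Real.exp_add]
          ring

/-- The second entry of the maximum in `radius` is made for this: it bounds the norm of either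
stage, plus K for the centre η. -/
theorem rk_mem_closedBall (hN : IsNoisyData a b δ η f η' f') (hF : InClass a b d ϱ K L η f)
    (hδ : δ ≤ 1) (hab : a < b) (hK : 0 < K) (hτ : ∀ j, τ j ∈ Icc (0 : ℝ) 1)
    {j : ℕ} (hj : j < n) :
    rkValue a b n η' f' τ j ∈ Metric.closedBall η (radius a b K) ∧
      rkStage a b n η' f' τ j ∈ Metric.closedBall η (radius a b K) := by
  have hn : 0 < n := (Nat.zero_le j).trans_lt hj
  have hn1 : (1 : ℝ) ≤ n := by exact_mod_cast hn
  have hh := step_pos hab hn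
  have hT := natCast_mul_step (a := a) (b := b) hn
  have hhT : step a b n ≤ b - a := by nlinarith
  have hT0 : 0 < b - a := sub_pos.2 hab
  have hv := norm_rkValue_add_le hN hF hδ hab hK hn hτ hj.le
  have hu := norm_rkStage_le hN hF hδ hab hτ hj
  have hη := hF.norm_init_le
  have hexp : Real.exp (j * (step a b n * K * (1 + step a b n * K))) ≤
      Real.exp (K * (b - a) * (1 + K * (b - a))) := by
    apply Real.exp_le_exp.2
    calc (j : ℝ) * (step a b n * K * (1 + step a b n * K))
        ≤ n * (step a b n * K * (1 + (b - a) * K)) := by gcongr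
      _ = n * step a b n * K * (1 + (b - a) * K) := by ring
      _ = _ := by rw [hT]; ring
  set h := step a b n
  set v := ‖rkValue a b n η' f' τ j‖ with hvdef
  set W := (1 / K + 1) * (Real.exp (K * (b - a) * (1 + K * (b - a))) * (1 + K) - 1) with hW
  have hvW : v ≤ W := by
    have : (1 / K + 1) * (1 + K) * Real.exp (j * (h * K * (1 + h * K))) ≤
      (1 / K + 1) * (1 + K) * Real.exp (K * (b - a) * (1 + K * (b - a))) := by gcongr
    rw [hW]; linarith
  have hv0 : 0 ≤ v := norm_nonneg _
  have hR : K + ((b - a) * (1 + K) + (1 + K * (b - a)) * W) ≤ radius a b K := by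
    refine le_trans (le_of_eq ?_) (le_max_right _ _)
    rw [hW]; ring
  have huW : ‖rkStage a b n η' f' τ j‖ ≤ (b - a) * (1 + K) + (1 + K * (b - a)) * W := by
    calc _ ≤ v + h * (K * (1 + v) + 1) := hu
      _ ≤ W + (b - a) * (K * (1 + W) + 1) := by gcongr
      _ = _ := by ring
  have hvu : v ≤ (b - a) * (1 + K) + (1 + K * (b - a)) * W := by
    have : 0 ≤ K * (b - a) * W := mul_nonneg (by positivity) (hv0.trans hvW)
    nlinarith [mul_pos hT0 hK]
  simp only [mem_closedBall_iff_norm]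
  constructor
  · exact (norm_sub_le _ _).trans (by linarith)
  · exact (norm_sub_le _ _).trans (by linarith)

/-- The quadrature error of the randomized midpoint rule on `[t_j, t_{j+1}]` along the solution. -/
noncomputable def quadError (a b : ℝ) (n : ℕ) (f : ℝ → Vec d → Vec d) (z : ℝ → Vec d) (j : ℕ)
    (x : ℝ) : Vec d :=
  step a b n • f (grid a b n j + x * step a b n) (z (grid a b n j + x * step a b n))
    - (z (grid a b n (j + 1)) - z (grid a b n j))

/-- Both the sampled slope and the mean slope are compared with the slope at the left end point. -/
theorem norm_quadError_le (hF : InClass a b d ϱ K L η f) (hab : a < b)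
    (hϱ0 : 0 < ϱ) (hϱ1 : ϱ ≤ 1) (hK : 0 < K) (hL : 0 < L) (hz : IsSolution a b η f z)
    (h1 : step a b n ≤ 1) {j : ℕ} (hj : j < n) {x : ℝ} (hx : x ∈ Icc (0 : ℝ) 1) :
    ‖quadError a b n f z j x‖ ≤ 2 * slopeHolder a b K L * step a b n ^ ϱ * step a b n := by
  have hn : 0 < n := (Nat.zero_le j).trans_lt hj
  have hh := step_pos hab hn
  have hg := grid_mem_Icc hab hn hj.le
  have hg' := grid_mem_Icc hab hn (Nat.succ_le_of_lt hj)
  have hs := grid_succ (a := a) (b := b) (n := n) j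
  have hgx := grid_add_mem_Icc hab hn hj hx
  have e1 := hF.norm_slope_sub_le hab.le hϱ0 hϱ1 hK hL hz hg hgx (h := step a b n) (by
    rw [add_sub_cancel_left, abs_of_nonneg (mul_nonneg hx.1 hh.le)]
    exact mul_le_of_le_one_left hh.le hx.2) h1
  have e2 := hF.norm_sub_sub_smul_slope_le hab.le hϱ0 hϱ1 hK hL hz hg hg' (h := step a b n)
    (by linarith) (by linarith) h1
  rw [hs, add_sub_cancel_left, ← hs] at e2
  have key : quadError a b n f z j x
      = step a b n • (f (grid a b n j + x * step a b n) (z (grid a b n j + x * step a b n))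
          - f (grid a b n j) (z (grid a b n j)))
        - (z (grid a b n (j + 1)) - z (grid a b n j)
          - step a b n • f (grid a b n j) (z (grid a b n j))) := by
    rw [quadError, smul_sub]; abel
  rw [key]
  refine (norm_sub_le _ _).trans ?_
  rw [norm_smul, Real.norm_eq_abs, abs_of_pos hh]
  nlinarith

/-- Discrete Gronwall inequality. -/
theorem le_exp_of_le_succ {u : ℕ → ℝ} {q B : ℝ} (hq : 0 ≤ q) (hB : 0 ≤ B) (hu0 : ∀ k, 0 ≤ u k)
    (hu : ∀ k < n, u (k + 1) ≤ (1 + q) * u k + B) {k : ℕ} (hk : k ≤ n) :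
    u k ≤ (u 0 + k * B) * Real.exp (k * q) := by
  induction k with
  | zero => simp
  | succ k ih =>
    have ih := ih (Nat.le_of_succ_le hk)
    have hE : Real.exp ((k + 1 : ℕ) * q) = Real.exp q * Real.exp (k * q) := by
      rw [← Real.exp_add]; congr 1; push_cast; ring
    have h1 : 1 ≤ Real.exp ((k + 1 : ℕ) * q) := Real.one_le_exp (by positivity)
    calc u (k + 1) ≤ (1 + q) * u k + B := hu k hk
      _ ≤ Real.exp q * ((u 0 + k * B) * Real.exp (k * q)) + B := by
          gcongr
          · exact hu0 k
          · linarith [Real.add_one_le_exp q]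
      _ = (u 0 + k * B) * Real.exp ((k + 1 : ℕ) * q) + B * 1 := by rw [hE]; ring
      _ ≤ (u 0 + k * B) * Real.exp ((k + 1 : ℕ) * q) + B * Real.exp ((k + 1 : ℕ) * q) := by
          gcongr
      _ = _ := by push_cast; ring

theorem norm_rkStage_sub_le (hN : IsNoisyData a b δ η f η' f') (hF : InClass a b d ϱ K L η f)
    (hδ : δ ≤ 1) (hab : a < b) (hϱ0 : 0 < ϱ) (hϱ1 : ϱ ≤ 1) (hK : 0 < K) (hL : 0 < L)
    (hz : IsSolution a b η f z) (h1 : step a b n ≤ 1) (hτ : ∀ j, τ j ∈ Icc (0 : ℝ) 1)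
    {j : ℕ} (hj : j < n) :
    ‖rkStage a b n η' f' τ j - z (grid a b n j + τ (j + 1) * step a b n)‖ ≤
      (1 + L) * ‖rkValue a b n η' f' τ j - z (grid a b n j)‖ + δ
        + slopeHolder a b K L * step a b n ^ ϱ * step a b n := by
  have hn : 0 < n := (Nat.zero_le j).trans_lt hj
  have hh := step_pos hab hn
  have hg := grid_mem_Icc hab hn hj.le
  have hx := hτ (j + 1)
  have hgx := grid_add_mem_Icc hab hn hj hx
  have hx0 : 0 ≤ τ (j + 1) * step a b n := mul_nonneg hx.1 hh.le
  have hxh : τ (j + 1) * step a b n ≤ step a b n := mul_le_of_le_one_left hh.le hx.2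
  have e2 := hF.norm_sub_sub_smul_slope_le hab.le hϱ0 hϱ1 hK hL hz hg hgx (h := step a b n)
    (by linarith) (by linarith) h1
  rw [add_sub_cancel_left] at e2
  have hball := hF.mem_closedBall hab.le hK hz _ hg
  have hVball := (rk_mem_closedBall hN hF hδ hab hK hτ hj).1
  have e3 := hF.lipschitz_space _ hg _ hVball _ hball
  have e4 := hN.norm_sub_le hg (rkValue a b n η' f' τ j)
  have hH := slopeHolder_pos hab.le hK hL
  set V := rkValue a b n η' f' τ j
  set t := grid a b n j
  set y := τ (j + 1) * step a b n with hy
  have key : rkStage a b n η' f' τ j - z (t + y)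
      = (V - z t) + y • (f' t V - f t V) + y • (f t V - f t (z t))
        - (z (t + y) - z t - y • f t (z t)) := by
    have : rkStage a b n η' f' τ j = V + y • f' t V := by rw [rkStage, hy, mul_comm]
    rw [this, smul_sub, smul_sub]; abel
  have n1 : ‖y • (f' t V - f t V)‖ ≤ δ := by
    rw [norm_smul, Real.norm_eq_abs, abs_of_nonneg hx0]
    calc y * ‖f' t V - f t V‖ ≤ 1 * δ := by gcongr; exact hxh.trans h1
      _ = δ := one_mul _
  have n2 : ‖y • (f t V - f t (z t))‖ ≤ L * ‖V - z t‖ := by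
    rw [norm_smul, Real.norm_eq_abs, abs_of_nonneg hx0]
    calc y * ‖f t V - f t (z t)‖ ≤ 1 * (L * ‖V - z t‖) := by gcongr; exact hxh.trans h1
      _ = _ := one_mul _
  have n3 : ‖z (t + y) - z t - y • f t (z t)‖ ≤
      slopeHolder a b K L * step a b n ^ ϱ * step a b n := e2.trans (by gcongr)
  rw [key]
  have m1 := norm_sub_le ((V - z t) + y • (f' t V - f t V) + y • (f t V - f t (z t)))
    (z (t + y) - z t - y • f t (z t))
  have m2 := norm_add₃_le (a := V - z t) (b := y • (f' t V - f t V))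
    (c := y • (f t V - f t (z t)))
  linarith

/-- The stability constant of the scheme. -/
noncomputable def stabilityConst (a b K L : ℝ) : ℝ :=
  Real.exp ((b - a) * (L * (1 + L)))
    * (1 + (b - a) * (1 + L * (1 + L) + L + L * slopeHolder a b K L)) + 1

theorem stabilityConst_pos (hab : a ≤ b) (hK : 0 < K) (hL : 0 < L) :
    0 < stabilityConst a b K L := by
  have := slopeHolder_pos hab hK hL
  have hT : 0 ≤ b - a := sub_nonneg.2 hab
  unfold stabilityConst
  positivity

/-- Stability: the error at the grid points is controlled by the noise level and the accumulated
quadrature errors. -/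
theorem norm_rkValue_sub_le (hN : IsNoisyData a b δ η f η' f') (hF : InClass a b d ϱ K L η f)
    (hδ0 : 0 ≤ δ) (hδ : δ ≤ 1) (hab : a < b) (hϱ0 : 0 < ϱ) (hϱ1 : ϱ ≤ 1) (hK : 0 < K) (hL : 0 < L)
    (hz : IsSolution a b η f z) (hn : 0 < n) (h1 : step a b n ≤ 1)
    (hτ : ∀ j, τ j ∈ Icc (0 : ℝ) 1) {A : ℝ}
    (hA : ∀ k ≤ n, ‖∑ j ∈ Finset.range k, quadError a b n f z j (τ (j + 1))‖ ≤ A)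
    {k : ℕ} (hk : k ≤ n) :
    ‖rkValue a b n η' f' τ k - z (grid a b n k)‖ ≤
      stabilityConst a b K L * (δ + step a b n ^ ϱ * step a b n + A) := by
  have hh := step_pos hab hn
  have hH := slopeHolder_pos hab.le hK hL
  have hA0 : 0 ≤ A := (norm_nonneg _).trans (hA 0 (Nat.zero_le _))
  set S : ℕ → Vec d := fun k => ∑ j ∈ Finset.range k, quadError a b n f z j (τ (j + 1)) with hS
  set V := rkValue a b n η' f' τ with hV
  set h := step a b n with hhdef
  set r := slopeHolder a b K L * h ^ ϱ * h with hr
  have hr0 : 0 ≤ r := by positivity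
  -- Removing S_k cancels the quadrature error of each step, so the recursion for u contains only
  -- noise, Lipschitz terms and the stage error. Randomness enters through A alone.
  set u : ℕ → ℝ := fun k => ‖V k - z (grid a b n k) - S k‖ with hu
  have heu : ∀ k ≤ n, ‖V k - z (grid a b n k)‖ ≤ u k + A := fun k hk => by
    have := norm_add_le (V k - z (grid a b n k) - S k) (S k)
    rw [sub_add_cancel] at this
    exact this.trans (by have := hA k hk; simp only [hu]; gcongr)
  set B := h * (δ + L * ((1 + L) * A + δ + r)) with hB
  have hB0 : 0 ≤ B := by positivity
  have hrec : ∀ k < n, u (k + 1) ≤ (1 + h * (L * (1 + L))) * u k + B := by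
    intro k hk
    have hst := norm_rkStage_sub_le hN hF hδ hab hϱ0 hϱ1 hK hL hz h1 hτ hk
    have hx := hτ (k + 1)
    have hgx := grid_add_mem_Icc hab hn hk hx
    have e3 := hF.lipschitz_space _ hgx _ (rk_mem_closedBall hN hF hδ hab hK hτ hk).2 _
      (hF.mem_closedBall hab.le hK hz _ hgx)
    have e4 := hN.norm_sub_le hgx (rkStage a b n η' f' τ k)
    have he := heu k hk.le
    set t := grid a b n k + τ (k + 1) * h with ht
    set Y := rkStage a b n η' f' τ k
    have key : V (k + 1) - z (grid a b n (k + 1)) - S (k + 1)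
        = (V k - z (grid a b n k) - S k) + h • ((f' t Y - f t Y) + (f t Y - f t (z t))) := by
      have hs1 : S (k + 1) = S k + quadError a b n f z k (τ (k + 1)) := Finset.sum_range_succ _ _
      rw [hs1, quadError, ← hhdef, ← ht, hV, rkValue_succ, sub_add_sub_cancel, smul_sub]
      abel
    calc u (k + 1) ≤ u k + h * (δ + L * ((1 + L) * (u k + A) + δ + r)) := by
          simp only [hu]
          rw [key]
          refine (norm_add_le _ _).trans ?_
          rw [norm_smul, Real.norm_eq_abs, abs_of_pos hh]
          gcongr
          refine (norm_add_le _ _).trans (add_le_add e4 (e3.trans ?_))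
          gcongr
          refine hst.trans ?_
          gcongr
      _ = _ := by rw [hB]; ring
  have hu0 : u 0 ≤ δ := by
    have : u 0 = ‖η' - η‖ := by simp [hu, hV, hS, rkValue, grid_zero, hz.1]
    rw [this]; exact mem_closedBall_iff_norm.1 hN.1
  have hgr := le_exp_of_le_succ (n := n) (u := u)
      (q := h * (L * (1 + L))) (by positivity) hB0 (fun k => norm_nonneg _) hrec hk
  have hkh : (k : ℝ) * h ≤ b - a := by
    rw [← natCast_mul_step (a := a) (b := b) hn]; gcongr
  have hT : 0 ≤ b - a := by linarith
  have hexp : Real.exp (k * (h * (L * (1 + L)))) ≤ Real.exp ((b - a) * (L * (1 + L))) := by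
    rw [← mul_assoc]; gcongr
  have hkB : (k : ℝ) * B ≤ (b - a) * (δ + L * ((1 + L) * A + δ + r)) := by
    rw [hB, ← mul_assoc]; gcongr
  have hpw : 0 ≤ h ^ ϱ * h := by positivity
  refine (heu k hk).trans ?_
  set E := Real.exp ((b - a) * (L * (1 + L)))
  set x := δ + h ^ ϱ * h + A with hx
  have hδx : δ ≤ x := by rw [hx]; linarith
  have hAx : A ≤ x := by rw [hx]; linarith
  have hrx : r ≤ slopeHolder a b K L * x := by
    rw [hr, mul_assoc]; gcongr; rw [hx]; linarith
  calc u k + A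
      ≤ (δ + (b - a) * (δ + L * ((1 + L) * A + δ + r))) * E + A := by
        gcongr
        exact hgr.trans (by gcongr)
    _ ≤ (x + (b - a) * (x + L * ((1 + L) * x + x + slopeHolder a b K L * x))) * E + x := by
        gcongr
    _ = stabilityConst a b K L * x := by unfold stabilityConst; ring

/-- The uniform error bound for a realization of the scheme. -/
theorem norm_sub_rkApprox_le (hN : IsNoisyData a b δ η f η' f') (hF : InClass a b d ϱ K L η f)
    (hδ0 : 0 ≤ δ) (hδ : δ ≤ 1) (hab : a < b) (hϱ0 : 0 < ϱ) (hϱ1 : ϱ ≤ 1) (hK : 0 < K) (hL : 0 < L)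
    (hz : IsSolution a b η f z) (hn : 0 < n) (h1 : step a b n ≤ 1)
    (hτ : ∀ j, τ j ∈ Icc (0 : ℝ) 1) {A : ℝ}
    (hA : ∀ k ≤ n, ‖∑ j ∈ Finset.range k, quadError a b n f z j (τ (j + 1))‖ ≤ A)
    {t : ℝ} (ht : t ∈ Icc a b) :
    ‖z t - rkApprox a b n η' f' τ t‖ ≤
      (stabilityConst a b K L + 2 * slopeHolder a b K L)
        * (δ + step a b n ^ ϱ * step a b n + A) := by
  obtain ⟨j, hj, htj⟩ := exists_mem_Icc_grid hab hn ht
  have hh := step_pos hab hn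
  have hH := slopeHolder_pos hab.le hK hL
  have hA0 : 0 ≤ A := (norm_nonneg _).trans (hA 0 (Nat.zero_le _))
  have hg := grid_mem_Icc hab hn hj.le
  have hg' := grid_mem_Icc hab hn (Nat.succ_le_of_lt hj)
  have hs := grid_succ (a := a) (b := b) (n := n) j
  have b0 := norm_rkValue_sub_le hN hF hδ0 hδ hab hϱ0 hϱ1 hK hL hz hn h1 hτ hA hj.le
  have b1 := norm_rkValue_sub_le hN hF hδ0 hδ hab hϱ0 hϱ1 hK hL hz hn h1 hτ hA
    (Nat.succ_le_of_lt hj)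
  have e1 := hF.norm_sub_sub_smul_slope_le hab.le hϱ0 hϱ1 hK hL hz hg ht (h := step a b n)
    htj.1 (by linarith [htj.2]) h1
  have e2 := hF.norm_sub_sub_smul_slope_le hab.le hϱ0 hϱ1 hK hL hz hg hg' (h := step a b n)
    (by linarith) (by linarith) h1
  rw [rkApprox_eq_rkSegment hab η' f' τ hj htj, rkSegment]
  have hstep : grid a b n (j + 1) - grid a b n j = step a b n := by rw [hs]; ring
  rw [hstep] at e2 ⊢
  set θ := (t - grid a b n j) / step a b n with hθ
  have hθ0 : 0 ≤ θ := div_nonneg (sub_nonneg.2 htj.1) hh.le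
  have hθ1 : θ ≤ 1 := (div_le_one hh).2 (by linarith [htj.2])
  have htθ : t - grid a b n j = θ * step a b n := (div_mul_cancel₀ _ hh.ne').symm
  rw [htθ] at e1
  set h := step a b n
  set x := δ + h ^ ϱ * h + A with hx
  set g := f (grid a b n j) (z (grid a b n j))
  set V := rkValue a b n η' f' τ
  set z0 := z (grid a b n j)
  set z1 := z (grid a b n (j + 1))
  -- The error at t splits into two Taylor remainders based at t_j, at t and at t_{j+1}, and a
  -- convex combination of the nodal errors.
  have key : z t - (θ • (V (j + 1) - V j) + V j)
      = (z t - z0 - (θ * h) • g) - θ • (z1 - z0 - h • g)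
        - ((1 - θ) • (V j - z0) + θ • (V (j + 1) - z1)) := by module
  have hpw : 0 ≤ h ^ ϱ * h := by positivity
  have hhx : h ^ ϱ * h ≤ x := by rw [hx]; linarith
  rw [key]
  have c1 : ‖z t - z0 - (θ * h) • g‖ ≤ slopeHolder a b K L * x := by
    refine e1.trans ?_
    calc slopeHolder a b K L * h ^ ϱ * (θ * h) ≤ slopeHolder a b K L * h ^ ϱ * (1 * h) := by
          gcongr
      _ = slopeHolder a b K L * (h ^ ϱ * h) := by ring
      _ ≤ _ := by gcongr
  have c2 : ‖θ • (z1 - z0 - h • g)‖ ≤ slopeHolder a b K L * x := by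
    rw [norm_smul, Real.norm_eq_abs, abs_of_nonneg hθ0]
    calc θ * ‖z1 - z0 - h • g‖ ≤ 1 * (slopeHolder a b K L * h ^ ϱ * h) := by gcongr
      _ = slopeHolder a b K L * (h ^ ϱ * h) := by ring
      _ ≤ _ := by gcongr
  have c3 : ‖(1 - θ) • (V j - z0) + θ • (V (j + 1) - z1)‖ ≤ stabilityConst a b K L * x := by
    refine (norm_add_le _ _).trans ?_
    rw [norm_smul, norm_smul, Real.norm_eq_abs, Real.norm_eq_abs, abs_of_nonneg hθ0,
      abs_of_nonneg (sub_nonneg.2 hθ1)]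
    calc (1 - θ) * ‖V j - z0‖ + θ * ‖V (j + 1) - z1‖
        ≤ (1 - θ) * (stabilityConst a b K L * x) + θ * (stabilityConst a b K L * x) := by
          have := sub_nonneg.2 hθ1
          gcongr
      _ = _ := by ring
  have m1 := norm_sub_le ((z t - z0 - (θ * h) • g) - θ • (z1 - z0 - h • g))
    ((1 - θ) • (V j - z0) + θ • (V (j + 1) - z1))
  have m2 := norm_sub_le (z t - z0 - (θ * h) • g) (θ • (z1 - z0 - h • g))
  linarith

end Scheme

/-! ### Measurability of the error -/

section Measurability

variable {a b K L ϱ δ : ℝ} {d n : ℕ} {η η' : Vec d} {f f' : ℝ → Vec d → Vec d} {z : ℝ → Vec d}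

/-- The extension by `0` of a right-hand side from `[a,b] × ℝ^d`. -/
noncomputable def zeroExtend (a b : ℝ) (f : ℝ → Vec d → Vec d) (t : ℝ) (x : Vec d) : Vec d :=
  open Classical in if t ∈ Icc a b then f t x else 0

theorem zeroExtend_of_mem {t : ℝ} (ht : t ∈ Icc a b) (x : Vec d) :
    zeroExtend a b f t x = f t x := if_pos ht

theorem IsNoisyData.measurable_zeroExtend (hN : IsNoisyData a b δ η f η' f')
    (hF : InClass a b d ϱ K L η f) :
    Measurable (fun q : ℝ × Vec d => zeroExtend a b f' q.1 q.2) := by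
  obtain ⟨-, e, he, hfe⟩ := hN
  have hset : MeasurableSet (Icc a b ×ˢ (univ : Set (Vec d))) := measurableSet_Icc.prod .univ
  refine measurable_of_restrict_of_restrict_compl hset ?_ ?_
  · have h1 : Measurable ((Icc a b ×ˢ (univ : Set (Vec d))).domRestrict
        fun q : ℝ × Vec d => f q.1 q.2) := hF.continuousOn.domRestrict.measurable
    have h2 : Measurable fun q : (Icc a b ×ˢ (univ : Set (Vec d)) : Set (ℝ × Vec d)) =>
        e q.1.1 q.1.2 :=
      he.measurable.comp (g := fun q : Icc a b × Vec d => e (q.1 : ℝ) q.2)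
        (f := fun q : (Icc a b ×ˢ (univ : Set (Vec d)) : Set (ℝ × Vec d)) =>
          ((⟨q.1.1, q.2.1⟩ : Icc a b), q.1.2)) (by fun_prop)
    convert! h1.add h2 using 1
    ext1 q
    simp [zeroExtend_of_mem q.2.1, hfe _ q.2.1]
  · convert! (measurable_const (a := (0 : Vec d))) using 1
    ext1 q
    have hq : q.1.1 ∉ Icc a b := fun h => q.2 ⟨h, mem_univ _⟩
    exact if_neg hq

theorem rkValue_congr {g : ℝ → Vec d → Vec d} (hab : a < b) (hn : 0 < n) {τ : ℕ → ℝ}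
    (hτ : ∀ j, τ j ∈ Icc (0 : ℝ) 1) (hg : ∀ t ∈ Icc a b, ∀ x, g t x = f t x) {j : ℕ}
    (hj : j ≤ n) : rkValue a b n η g τ j = rkValue a b n η f τ j := by
  induction j with
  | zero => rfl
  | succ j ih =>
    simp only [rkValue, ih (Nat.le_of_succ_le hj),
      hg _ (grid_mem_Icc hab hn (Nat.le_of_succ_le hj)),
      hg _ (grid_add_mem_Icc hab hn (Nat.lt_of_succ_le hj) (hτ (j + 1)))]

variable {Ω : Type*} [MeasurableSpace Ω] {P : Measure Ω}

theorem measurable_rkValue {g : ℝ → Vec d → Vec d}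
    (hg : Measurable (fun q : ℝ × Vec d => g q.1 q.2)) {τ : ℕ → Ω → ℝ} (hτ : ∀ j, Measurable (τ j))
    (η : Vec d) (j : ℕ) : Measurable (fun ω => rkValue a b n η g (fun i => τ i ω) j) := by
  have hcomp : ∀ {s : Ω → ℝ} {Y : Ω → Vec d}, Measurable s → Measurable Y →
      Measurable fun ω => g (s ω) (Y ω) := fun hs hY => hg.comp (hs.prodMk hY)
  induction j with
  | zero => exact measurable_const
  | succ j ih =>
    have h1 := hτ (j + 1)
    have h2 := hcomp measurable_const ih (s := fun _ => grid a b n j)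
    have h3 := hcomp ((h1.mul_const (step a b n)).const_add (grid a b n j))
      (ih.add ((h1.const_mul (step a b n)).smul h2))
    exact ih.add (h3.const_smul (step a b n))

/-- By continuity in u, the supremum may be taken over a countable dense set of times. -/
theorem measurable_iSup_enorm_Icc {l : Ω → ℝ → Vec d} {s t : ℝ} (hz : ContinuousOn z (Icc s t))
    (hl : ∀ ω, Continuous (l ω)) (hm : ∀ u, Measurable fun ω => l ω u) :
    Measurable fun ω => ⨆ u ∈ Icc s t, ‖z u - l ω u‖ₑ := by
  obtain ⟨D, hDc, hD⟩ := TopologicalSpace.exists_countable_dense (Icc s t)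
  have : (fun ω => ⨆ u ∈ Icc s t, ‖z u - l ω u‖ₑ)
      = fun ω => ⨆ u : D, ‖z (u : Icc s t) - l ω (u : Icc s t)‖ₑ := by
    ext1 ω
    have hc : Continuous fun u : Icc s t => ‖z u - l ω u‖ₑ :=
      (hz.domRestrict.sub ((hl ω).comp continuous_subtype_val)).enorm
    rw [hD.ciSup' hc, iSup_subtype']
  rw [this]
  have := hDc.to_subtype
  exact Measurable.iSup fun u => (measurable_const.sub (hm _)).enorm

/-- Each `rkSegment` is affine in t, hence continuous on its whole interval, so no continuity of the
floor-based `rkApprox` across the nodes has to be shown. -/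
theorem supDist_eq_iSup (hab : a < b) (hn : 0 < n) (η : Vec d) (f : ℝ → Vec d → Vec d)
    (τ : ℕ → ℝ) (z : ℝ → Vec d) :
    supDist a b z (rkApprox a b n η f τ) = ⨆ j : Fin n,
      ⨆ t ∈ Icc (grid a b n j) (grid a b n (j + 1)), ‖z t - rkSegment a b n η f τ j t‖ₑ := by
  refine le_antisymm ?_ ?_
  · refine iSup₂_le fun t ht => ?_
    obtain ⟨j, hj, htj⟩ := exists_mem_Icc_grid hab hn ht
    rw [rkApprox_eq_rkSegment hab η f τ hj htj]
    exact le_iSup_of_le ⟨j, hj⟩ (le_iSup₂_of_le t htj le_rfl)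
  · refine iSup_le fun j => iSup₂_le fun t ht => ?_
    rw [← rkApprox_eq_rkSegment hab η f τ j.2 ht]
    exact le_iSup₂_of_le (f := fun t _ => ‖z t - rkApprox a b n η f τ t‖ₑ) t
      ⟨(grid_mem_Icc hab hn j.2.le).1.trans ht.1,
        ht.2.trans (grid_mem_Icc hab hn (Nat.succ_le_of_lt j.2)).2⟩ le_rfl

theorem measurable_supDist {g : ℝ → Vec d → Vec d}
    (hg : Measurable (fun q : ℝ × Vec d => g q.1 q.2)) {τ : ℕ → Ω → ℝ} (hτ : ∀ j, Measurable (τ j))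
    (hab : a < b) (hn : 0 < n) (η : Vec d) (hz : ContinuousOn z (Icc a b)) :
    Measurable fun ω => supDist a b z (rkApprox a b n η g (fun i => τ i ω)) := by
  simp only [supDist_eq_iSup hab hn]
  refine Measurable.iSup fun j => measurable_iSup_enorm_Icc ?_ (fun ω => ?_) fun u => ?_
  · exact hz.mono (Icc_subset_Icc (grid_mem_Icc hab hn j.2.le).1
      (grid_mem_Icc hab hn (Nat.succ_le_of_lt j.2)).2)
  · unfold rkSegment; fun_prop
  · have h1 := measurable_rkValue (a := a) (b := b) (n := n) hg hτ η j
    have h2 := measurable_rkValue (a := a) (b := b) (n := n) hg hτ η (j + 1)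
    exact ((h2.sub h1).const_smul
      ((u - grid a b n j) / (grid a b n (j + 1) - grid a b n j))).add h1

/-- Noisy data are constrained only on [a, b]. The zero extension is Borel everywhere and yields the
same scheme whenever all τ_j lie in [0, 1], that is, almost surely. -/
theorem aemeasurable_supDist (hN : IsNoisyData a b δ η f η' f') (hF : InClass a b d ϱ K L η f)
    {τ : ℕ → Ω → ℝ} (hτ : ∀ j, Measurable (τ j)) (hτ01 : ∀ᵐ ω ∂P, ∀ j, τ j ω ∈ Icc (0 : ℝ) 1)
    (hab : a < b) (hn : 0 < n) (hz : ContinuousOn z (Icc a b)) :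
    AEMeasurable (fun ω => supDist a b z (rkApprox a b n η' f' (fun i => τ i ω))) P := by
  refine ⟨_, measurable_supDist (hN.measurable_zeroExtend hF) hτ hab hn η' hz, ?_⟩
  filter_upwards [hτ01] with ω hω
  have hV : ∀ j ≤ n, rkValue a b n η' (zeroExtend a b f') (fun i => τ i ω) j
      = rkValue a b n η' f' (fun i => τ i ω) j := fun j hj =>
    rkValue_congr hab hn hω (fun t ht x => zeroExtend_of_mem ht x) hj
  simp only [supDist_eq_iSup hab hn, rkSegment]
  refine iSup_congr fun j => ?_
  rw [hV j j.2.le, hV (j + 1) (Nat.succ_le_of_lt j.2)]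

end Measurability

/-! ### Uniform random variables -/

section Uniform

variable {Ω : Type*} [MeasurableSpace Ω] {P : Measure Ω}

theorem map_eq_of_isUniform_Icc {X : Ω → ℝ} (hu : pdf.IsUniform X (Icc 0 1) P volume) :
    P.map X = volume.restrict (Icc 0 1) := by
  rw [pdf.IsUniform] at hu
  rw [hu, ProbabilityTheory.cond]
  simp

theorem ae_mem_Icc_of_isUniform {τ : ℕ → Ω → ℝ} (hτ : ∀ j, Measurable (τ j))
    (hu : ∀ j, pdf.IsUniform (τ j) (Icc 0 1) P volume) :
    ∀ᵐ ω ∂P, ∀ j, τ j ω ∈ Icc (0 : ℝ) 1 := by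
  refine ae_all_iff.2 fun j => ?_
  have h : ∀ᵐ x ∂(P.map (τ j)), x ∈ Icc (0 : ℝ) 1 := by
    rw [map_eq_of_isUniform_Icc (hu j)]
    exact ae_restrict_mem measurableSet_Icc
  exact ae_of_ae_map (hτ j).aemeasurable h

theorem integral_comp_of_isUniform {X : Ω → ℝ} (hX : Measurable X)
    (hu : pdf.IsUniform X (Icc 0 1) P volume) {φ : ℝ → ℝ} (hφ : Continuous φ) :
    ∫ ω, φ (X ω) ∂P = ∫ x in (0 : ℝ)..1, φ x := by
  rw [← integral_map hX.aemeasurable hφ.aestronglyMeasurable, map_eq_of_isUniform_Icc hu,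
    intervalIntegral.integral_of_le zero_le_one, integral_Icc_eq_integral_Ioc]

end Uniform

/-! ### The quadrature error has mean zero -/

section QuadError

variable {a b K L ϱ : ℝ} {d n : ℕ} {η : Vec d} {f : ℝ → Vec d → Vec d} {z : ℝ → Vec d}

theorem InClass.continuousOn_slope (hF : InClass a b d ϱ K L η f) (hz : IsSolution a b η f z) :
    ContinuousOn (fun t => f t (z t)) (Icc a b) :=
  hF.continuousOn.comp (f := fun t => (t, z t))
    (continuousOn_id.prodMk fun t ht => (hz.2 t ht).continuousWithinAt) fun _ ht => ⟨ht, mem_univ _⟩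

theorem continuousOn_quadError (hF : InClass a b d ϱ K L η f) (hz : IsSolution a b η f z)
    (hab : a < b) {j : ℕ} (hj : j < n) : ContinuousOn (quadError a b n f z j) (Icc 0 1) := by
  have hn : 0 < n := (Nat.zero_le j).trans_lt hj
  have h1 : ContinuousOn (fun x : ℝ => f (grid a b n j + x * step a b n)
      (z (grid a b n j + x * step a b n))) (Icc 0 1) :=
    (hF.continuousOn_slope hz).comp (f := fun x => grid a b n j + x * step a b n) (by fun_prop)
      fun x hx => grid_add_mem_Icc hab hn hj hx
  exact (h1.const_smul (step a b n)).sub continuousOn_const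

/-- The sampled term is the derivative of x ↦ z(t_j + xh), so its integral over [0, 1] is exactly
the increment of z. -/
theorem integral_quadError_eq_zero (hF : InClass a b d ϱ K L η f) (hz : IsSolution a b η f z)
    (hab : a < b) {j : ℕ} (hj : j < n) : ∫ x in (0 : ℝ)..1, quadError a b n f z j x = 0 := by
  have hn : 0 < n := (Nat.zero_le j).trans_lt hj
  have hh := step_pos hab hn
  set t := grid a b n j with ht
  set h := step a b n with hhdef
  have hmaps : ∀ x ∈ Icc (0 : ℝ) 1, t + x * h ∈ Icc a b := fun x hx =>
    grid_add_mem_Icc hab hn hj hx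
  have hcont : ContinuousOn (fun x => z (t + x * h)) (Icc 0 1) :=
    ContinuousOn.comp (t := Icc a b) (g := z) (f := fun x => t + x * h)
      (fun u hu => (hz.2 u hu).continuousWithinAt) (by fun_prop) hmaps
  have hint : IntervalIntegrable (fun x => h • f (t + x * h) (z (t + x * h))) volume 0 1 := by
    refine ContinuousOn.intervalIntegrable ?_
    rw [uIcc_of_le zero_le_one]
    exact ((hF.continuousOn_slope hz).comp (f := fun x => t + x * h) (by fun_prop)
      hmaps).const_smul h
  have hftc := intervalIntegral.integral_eq_sub_of_hasDerivAt_of_le zero_le_one hcont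
    (f' := fun x => h • f (t + x * h) (z (t + x * h))) (fun x hx => by
      have hlt : t + x * h ∈ Ioo a b := by
        have h0 := hmaps 0 (left_mem_Icc.2 zero_le_one)
        have h1 := hmaps 1 (right_mem_Icc.2 zero_le_one)
        constructor
        · nlinarith [h0.1, mul_pos hx.1 hh]
        · nlinarith [h1.2, mul_lt_mul_of_pos_right hx.2 hh]
      have hd := (hz.2 _ (Ioo_subset_Icc_self hlt)).hasDerivAt (Icc_mem_nhds hlt.1 hlt.2)
      have hd2 : HasDerivAt (fun x : ℝ => t + x * h) h x := by
        simpa using ((hasDerivAt_id x).mul_const h).const_add t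
      exact hd.scomp x hd2) hint
  have hsucc : t + 1 * h = grid a b n (j + 1) := by rw [grid_succ, one_mul]
  rw [hsucc, zero_mul, add_zero] at hftc
  simp only [quadError, ← ht, ← hhdef]
  rw [intervalIntegral.integral_sub hint intervalIntegrable_const, hftc,
    intervalIntegral.integral_const]
  simp

end QuadError

/-! ### Moments of the maximal accumulated quadrature error -/

section Moments

variable {a b K L ϱ p : ℝ} {d n : ℕ} {η : Vec d} {f : ℝ → Vec d → Vec d} {z : ℝ → Vec d}

/-- The coordinates of the quadrature errors, as functions on all of `ℝ`, with the indexing of the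
random variables `τ 1, τ 2, …`. -/
noncomputable def coordError (a b : ℝ) (n : ℕ) (f : ℝ → Vec d → Vec d) (z : ℝ → Vec d)
    (i : Fin d) : ℕ → ℝ → ℝ
  | 0, _ => 0
  | j + 1, x => if j < n then quadError a b n f z j (projIcc (0 : ℝ) 1 zero_le_one x) i else 0

theorem coordError_succ {i : Fin d} {j : ℕ} (hj : j < n) {x : ℝ} (hx : x ∈ Icc (0 : ℝ) 1) :
    coordError a b n f z i (j + 1) x = quadError a b n f z j x i := by
  simp only [coordError, if_pos hj, projIcc_of_mem zero_le_one hx]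

/-- Clamping the argument to [0, 1] and setting the value to 0 past the n-th step make the functions
continuous and bounded on all of ℝ. The maximal inequality then applies with bounds at every ω, not
merely almost surely. -/
theorem continuous_coordError (hF : InClass a b d ϱ K L η f) (hz : IsSolution a b η f z)
    (hab : a < b) (i : Fin d) (m : ℕ) : Continuous (coordError a b n f z i m) := by
  cases m with
  | zero => exact continuous_const
  | succ j =>
    by_cases hj : j < n
    · have h1 := (continuousOn_quadError hF hz hab hj).domRestrict.comp
        (continuous_projIcc (h := zero_le_one))
      have h2 : coordError a b n f z i (j + 1)
          = fun x => ((Icc (0 : ℝ) 1).domRestrict (quadError a b n f z j) ∘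
            projIcc (0 : ℝ) 1 zero_le_one) x i := by
        ext x; simp only [coordError, if_pos hj, Function.comp, domRestrict_apply]
      rw [h2]
      exact (PiLp.continuous_apply 1 _ i).comp h1
    · have h2 : coordError a b n f z i (j + 1) = fun _ => 0 := by
        ext x; simp only [coordError, if_neg hj]
      rw [h2]; exact continuous_const

theorem abs_coordError_le (hF : InClass a b d ϱ K L η f) (hab : a < b)
    (hϱ0 : 0 < ϱ) (hϱ1 : ϱ ≤ 1) (hK : 0 < K) (hL : 0 < L) (hz : IsSolution a b η f z)
    (hn : 0 < n) (h1 : step a b n ≤ 1) (i : Fin d) (m : ℕ) (x : ℝ) :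
    |coordError a b n f z i m x| ≤ 2 * slopeHolder a b K L * step a b n ^ ϱ * step a b n := by
  have hh := step_pos hab hn
  have hH := slopeHolder_pos hab.le hK hL
  have h0 : 0 ≤ 2 * slopeHolder a b K L * step a b n ^ ϱ * step a b n := by positivity
  cases m with
  | zero => simpa [coordError] using h0
  | succ j =>
    by_cases hj : j < n
    · rw [coordError, if_pos hj]
      exact (PiLp.norm_apply_le _ i).trans
        (norm_quadError_le hF hab hϱ0 hϱ1 hK hL hz h1 hj (Subtype.prop _))
    · simpa [coordError, hj] using h0

theorem integral_coordError (hF : InClass a b d ϱ K L η f) (hab : a < b)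
    (hz : IsSolution a b η f z) (i : Fin d) (m : ℕ) :
    ∫ x in (0 : ℝ)..1, coordError a b n f z i m x = 0 := by
  cases m with
  | zero => simp [coordError]
  | succ j =>
    by_cases hj : j < n
    · have h1 : ∫ x in (0 : ℝ)..1, coordError a b n f z i (j + 1) x
          = ∫ x in (0 : ℝ)..1, quadError a b n f z j x i := by
        refine intervalIntegral.integral_congr fun x hx => ?_
        rw [uIcc_of_le zero_le_one] at hx
        exact coordError_succ hj hx
      have h2 : IntervalIntegrable (quadError a b n f z j) volume 0 1 := by
        refine ContinuousOn.intervalIntegrable ?_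
        rw [uIcc_of_le zero_le_one]
        exact continuousOn_quadError hF hz hab hj
      have h3 := (PiLp.proj (𝕜 := ℝ) 1 (fun _ : Fin d => ℝ) i).intervalIntegral_comp_comm h2
      rw [integral_quadError_eq_zero hF hz hab hj, map_zero] at h3
      rw [h1]
      exact h3
    · simp [coordError, hj]

/-- Origin of the rate: √n·h = √(b − a)·√h, so n centred errors of size h^{ϱ+1} accumulate to order
h^{ϱ+1/2} instead of h^ϱ. -/
theorem step_rpow_mul_mul_sqrt (hab : a < b) (hn : 0 < n) :
    step a b n ^ ϱ * step a b n * √n = √(b - a) * step a b n ^ (ϱ + 1 / 2) := by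
  have hh := step_pos hab hn
  have h1 : step a b n ^ (ϱ + 1 / 2) = step a b n ^ ϱ * √(step a b n) := by
    rw [Real.rpow_add hh, Real.sqrt_eq_rpow]
  have h2 : √(b - a) = √n * √(step a b n) := by
    rw [← natCast_mul_step (a := a) (b := b) hn, Real.sqrt_mul (Nat.cast_nonneg n)]
  rw [h1, h2]
  nth_rewrite 2 [← Real.mul_self_sqrt hh.le]
  ring

variable {Ω : Type*}

/-- The constant in the maximal inequality `eLpNorm_partialSups_abs_sum_le`. -/
noncomputable def maximalConst (p : ℝ) : ℝ := (p ^ p * (8 * Real.exp 2)) ^ (1 / p)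

/-- The maximal accumulated quadrature error in the coordinate `i`. -/
noncomputable def maxCoordError (a b : ℝ) (n : ℕ) (f : ℝ → Vec d → Vec d) (z : ℝ → Vec d)
    (τ : ℕ → Ω → ℝ) (i : Fin d) (ω : Ω) : ℝ :=
  partialSups (fun k => |∑ j ∈ Finset.range k, coordError a b n f z i (j + 1) (τ (j + 1) ω)|) n

/-- In the ℓ¹ norm the vector maximum is at most the sum of the coordinate maxima, which later costs
the factor d. -/
theorem norm_sum_quadError_le {τ : ℕ → Ω → ℝ} {ω : Ω} (hω : ∀ j, τ j ω ∈ Icc (0 : ℝ) 1)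
    {k : ℕ} (hk : k ≤ n) :
    ‖∑ j ∈ Finset.range k, quadError a b n f z j (τ (j + 1) ω)‖
      ≤ ∑ i, maxCoordError a b n f z τ i ω := by
  rw [PiLp.norm_eq_of_L1]
  refine Finset.sum_le_sum fun i _ => ?_
  refine le_trans (le_of_eq ?_) (le_partialSups_of_le (fun k =>
    |∑ j ∈ Finset.range k, coordError a b n f z i (j + 1) (τ (j + 1) ω)|) hk)
  rw [Real.norm_eq_abs]
  congr 1
  rw [WithLp.ofLp_sum, Finset.sum_apply]
  exact Finset.sum_congr rfl fun j hj =>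
    (coordError_succ ((Finset.mem_range.1 hj).trans_le hk) (hω _)).symm

variable [MeasurableSpace Ω] {P : Measure Ω} [IsProbabilityMeasure P]

theorem eLpNorm_maxCoordError_le (hF : InClass a b d ϱ K L η f) (hab : a < b)
    (hϱ0 : 0 < ϱ) (hϱ1 : ϱ ≤ 1) (hK : 0 < K) (hL : 0 < L) (hz : IsSolution a b η f z)
    (hn : 0 < n) (h1 : step a b n ≤ 1) (hp : 0 < p) {τ : ℕ → Ω → ℝ} (hτ : ∀ j, Measurable (τ j))
    (hind : iIndepFun τ P) (hu : ∀ j, pdf.IsUniform (τ j) (Icc 0 1) P volume) (i : Fin d) :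
    eLpNorm (maxCoordError a b n f z τ i) (ENNReal.ofReal p) P ≤
      ENNReal.ofReal (maximalConst p * (2 * slopeHolder a b K L * √(b - a))
        * step a b n ^ (ϱ + 1 / 2)) := by
  have hh := step_pos hab hn
  have hH := slopeHolder_pos hab.le hK hL
  have hcont := continuous_coordError (n := n) hF hz hab i
  refine (eLpNorm_partialSups_abs_sum_le (ξ := fun m ω => coordError a b n f z i m (τ m ω))
    (c := 2 * slopeHolder a b K L * step a b n ^ ϱ * step a b n)
    (fun m => (hcont m).measurable.comp (hτ m))
    (hind.comp _ fun m => (hcont m).measurable)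
    (fun m => (integral_comp_of_isUniform (hτ m) (hu m) (hcont m)).trans
      (integral_coordError hF hab hz i m))
    (fun m ω => abs_coordError_le hF hab hϱ0 hϱ1 hK hL hz hn h1 i m _)
    hp hn (by positivity)).trans_eq ?_
  have := step_rpow_mul_mul_sqrt (ϱ := ϱ) hab hn
  congr 1
  unfold maximalConst
  linear_combination (p ^ p * (8 * Real.exp 2)) ^ (1 / p) * (2 * slopeHolder a b K L) * this

theorem measurable_maxCoordError (hF : InClass a b d ϱ K L η f) (hab : a < b)
    (hz : IsSolution a b η f z) {τ : ℕ → Ω → ℝ} (hτ : ∀ j, Measurable (τ j)) (i : Fin d) :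
    Measurable (maxCoordError a b n f z τ i) := by
  have h1 : ∀ k, Measurable fun ω =>
      |∑ j ∈ Finset.range k, coordError a b n f z i (j + 1) (τ (j + 1) ω)| := fun k =>
    (Finset.measurable_fun_sum _ fun j _ =>
      (continuous_coordError hF hz hab i (j + 1)).measurable.comp (hτ (j + 1))).abs
  have h2 : ∀ m, Measurable fun ω => partialSups (fun k =>
      |∑ j ∈ Finset.range k, coordError a b n f z i (j + 1) (τ (j + 1) ω)|) m := fun m => by
    induction m with
    | zero => exact h1 0
    | succ m ih => simp only [partialSups_add_one]; exact ih.max (h1 (m + 1))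
  exact h2 n

end Moments

/-! ### Assembly of the error estimate -/

theorem step_le_one {a b : ℝ} (hab : a < b) {n : ℕ} (hn : ⌊b - a⌋₊ + 1 ≤ n) :
    step a b n ≤ 1 := by
  have h1 : b - a < n := (Nat.lt_floor_add_one _).trans_le (by exact_mod_cast hn)
  exact (div_le_one ((sub_pos.2 hab).trans h1)).2 h1.le

end RandomizedRK

theorem theorem2p2 (a b : ℝ) (hab : a < b) (d : ℕ) (ϱ K L p : ℝ) (hϱ0 : 0 < ϱ) (hϱ1 : ϱ ≤ 1)
    (hK : 0 < K) (hL : 0 < L) (hp : 2 ≤ p) :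
    ∃ C : ℝ, 0 < C ∧
      ∀ (η : RandomizedRK.Vec d) (f : ℝ → RandomizedRK.Vec d → RandomizedRK.Vec d),
        RandomizedRK.InClass a b d ϱ K L η f →
        ∃ z : ℝ → RandomizedRK.Vec d,
          RandomizedRK.IsSolution a b η f z ∧
          (∀ y : ℝ → RandomizedRK.Vec d,
            RandomizedRK.IsSolution a b η f y → Set.EqOn y z (Set.Icc a b)) ∧
          ∀ (Ω : Type*) [MeasurableSpace Ω] (P : MeasureTheory.Measure Ω)
            [MeasureTheory.IsProbabilityMeasure P] (τ : ℕ → Ω → ℝ),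
            (∀ j, Measurable (τ j)) →
            ProbabilityTheory.iIndepFun τ P →
            (∀ j, MeasureTheory.pdf.IsUniform (τ j) (Set.Icc 0 1) P MeasureTheory.volume) →
            ∀ (n : ℕ) (δ : ℝ), ⌊b - a⌋₊ + 1 ≤ n → 0 ≤ δ → δ ≤ 1 →
            ∀ (η' : RandomizedRK.Vec d) (f' : ℝ → RandomizedRK.Vec d → RandomizedRK.Vec d),
              RandomizedRK.IsNoisyData a b δ η f η' f' →
              AEMeasurable (fun ω => RandomizedRK.supDist a b z
                (RandomizedRK.rkApprox a b n η' f' (fun j => τ j ω))) P ∧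
              MeasureTheory.eLpNorm (fun ω => RandomizedRK.supDist a b z
                (RandomizedRK.rkApprox a b n η' f' (fun j => τ j ω))) (ENNReal.ofReal p) P
                ≤ ENNReal.ofReal (C * (RandomizedRK.step a b n ^ (ϱ + 1 / 2) + δ)) := by
  open RandomizedRK in
  have hp0 : 0 < p := by linarith
  have hH := slopeHolder_pos hab.le hK hL
  have hS := stabilityConst_pos hab.le hK hL
  have hD : 0 ≤ maximalConst p := by unfold maximalConst; positivity
  set C₁ := stabilityConst a b K L + 2 * slopeHolder a b K L with hC₁
  set C₂ := maximalConst p * (2 * slopeHolder a b K L * √(b - a)) with hC₂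
  have hC₁0 : 0 < C₁ := by positivity
  have hC₂0 : 0 ≤ C₂ := by positivity
  refine ⟨C₁ * (1 + d * C₂), by positivity, fun η f hF => ?_⟩
  obtain ⟨z, hz⟩ := hF.exists_solution hab.le hK hL
  refine ⟨z, hz, fun y hy => hF.eqOn_solution hab.le hK hL hy hz, ?_⟩
  intro Ω _ P _ τ hτ hind hu n δ hn hδ0 hδ1 η' f' hN
  have hn0 : 0 < n := (Nat.succ_pos _).trans_le hn
  have h1 := step_le_one hab hn
  have hh := step_pos hab hn0
  have hτ01 := ae_mem_Icc_of_isUniform hτ hu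
  refine ⟨aemeasurable_supDist hN hF hτ hτ01 hab hn0
    fun t ht => (hz.2 t ht).continuousWithinAt, ?_⟩
  set r := step a b n ^ (ϱ + 1 / 2) with hr
  have hr0 : 0 ≤ r := by positivity
  -- The deterministic local error h^{ϱ+1} is of higher order than the random one because h ≤ 1.
  have hstep : step a b n ^ ϱ * step a b n ≤ r := by
    rw [hr, ← Real.rpow_add_one hh.ne']
    exact Real.rpow_le_rpow_of_exponent_ge hh h1 (by linarith)
  have hm : ∀ i, Measurable (maxCoordError a b n f z τ i) := measurable_maxCoordError hF hab hz hτ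
  have hpw : ∀ᵐ ω ∂P, ‖supDist a b z (rkApprox a b n η' f' (fun j => τ j ω))‖ₑ ≤
      ‖C₁ * (δ + r + ∑ i, maxCoordError a b n f z τ i ω)‖ₑ := by
    filter_upwards [hτ01] with ω hω
    rw [enorm_eq_self]
    refine iSup₂_le fun t ht => enorm_le_iff_norm_le.2 ?_
    refine (norm_sub_rkApprox_le hN hF hδ0 hδ1 hab hϱ0 hϱ1 hK hL hz hn0 h1 hω
      (fun k hk => norm_sum_quadError_le hω hk) ht).trans ((le_abs_self _).trans' ?_)
    gcongr
  have hp1 : 1 ≤ ENNReal.ofReal p := by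
    rw [← ENNReal.ofReal_one]; exact ENNReal.ofReal_le_ofReal (by linarith)
  have hsum : eLpNorm (fun ω => ∑ i, maxCoordError a b n f z τ i ω) (ENNReal.ofReal p) P ≤
      ENNReal.ofReal (d * (C₂ * r)) := by
    have hfun : (fun ω => ∑ i, maxCoordError a b n f z τ i ω)
        = ∑ i, maxCoordError a b n f z τ i := by ext ω; simp
    rw [hfun]
    refine (MeasureTheory.eLpNorm_sum_le (fun i _ => (hm i).aestronglyMeasurable) hp1).trans ?_
    refine (Finset.sum_le_sum fun i _ => eLpNorm_maxCoordError_le hF hab hϱ0 hϱ1 hK hL hz hn0 h1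
      hp0 hτ hind hu i).trans_eq ?_
    rw [Finset.sum_const, Finset.card_univ, Fintype.card_fin, nsmul_eq_mul,
      ENNReal.ofReal_mul (Nat.cast_nonneg d), ENNReal.ofReal_natCast]
  have hconst : eLpNorm (fun _ : Ω => δ + r) (ENNReal.ofReal p) P = ENNReal.ofReal (δ + r) := by
    rw [MeasureTheory.eLpNorm_const _ (by simpa using hp0) (NeZero.ne P), measure_univ,
      ENNReal.one_rpow, mul_one, Real.enorm_of_nonneg (by positivity)]
  calc _ ≤ eLpNorm (fun ω => C₁ * (δ + r + ∑ i, maxCoordError a b n f z τ i ω))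
        (ENNReal.ofReal p) P := MeasureTheory.eLpNorm_mono_enorm_ae hpw
    _ = ENNReal.ofReal C₁ * eLpNorm (fun ω => δ + r + ∑ i, maxCoordError a b n f z τ i ω)
        (ENNReal.ofReal p) P := by
      rw [← Real.enorm_of_nonneg hC₁0.le]
      exact MeasureTheory.eLpNorm_const_smul C₁ _ _ _
    _ ≤ ENNReal.ofReal C₁ * (ENNReal.ofReal (δ + r) + ENNReal.ofReal (d * (C₂ * r))) := by
      gcongr
      rw [← hconst]
      refine (MeasureTheory.eLpNorm_add_le aestronglyMeasurable_const
        (Finset.measurable_fun_sum _ fun i _ => hm i).aestronglyMeasurable hp1).trans ?_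
      gcongr
    _ = ENNReal.ofReal (C₁ * (δ + r + d * (C₂ * r))) := by
      rw [← ENNReal.ofReal_add (by positivity) (by positivity), ← ENNReal.ofReal_mul hC₁0.le]
    _ ≤ _ := by
      refine ENNReal.ofReal_le_ofReal ?_
      -- This is precisely the amount by which C₁(1 + d·C₂)(r + δ) exceeds the bound obtained.
      have h2 : 0 ≤ C₁ * (d * C₂ * δ) := by positivity
      linarith
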